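/- Let $V$ be a nonempty finite set of variables, let the variable $v\in V$ take values in a finite set $\mathcal X_v$ with $|\mathcal X_v|\le d$, and let $\mathcal X_A=\prod_{v\in A}\mathcal X_v$ for $A\subseteq V$. A decomposable model on a chordal graph $G$ with vertex set $V$ is a strictly positive probability distribution $\mathbb P$ on $\mathcal X_V$ with $\mathbb P(x)=\prod_{C}\mathbb P^{\mathcal T}_C(x_C)$, where $C$ ranges over the maximal cliques of $G$ and $\mathbb P^{\mathcal T}_C(x_C)=\mathbb P_C(x_C)/\mathbb P_S(x_S)$ are the conditional probability tables along a rooted clique tree of $G$ ($S$ is the intersection of $C$ with its parent, empty for the root). Let $Y,Z\subseteq V$ be disjoint. For distributions $\mathbb P,\mathbb Q$ on $\mathcal X_V$, the conditional $\alpha\beta$-divergence at $\alpha=\beta=0$ is $$D^{(0,0)}_{AB}(\mathbb P_{Y\mid Z}\,\|\,\mathbb Q_{Y\mid Z})=\sum_{z\in\mathcal X_Z}\mathbb P_Z(z)\sum_{y\in\mathcal X_Y}\tfrac12\bigl(\log \mathbb P_{Y\mid Z}(y\mid z)-\log \mathbb Q_{Y\mid Z}(y\mid z)\bigr)^2 .$$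 An $\mathcal N$-partition of $G$ for $Z$ is a set $\mathcal N$ of subsets of $V$ such that every maximal clique of $G$ is a maximal clique of the induced subgraph $G(N)$ for exactly one $N\in\mathcal N$, every maximal clique of every $G(N)$, $N\in\mathcal N$, is a maximal clique of $G$, and every $v\in V\setminus Z$ lies in exactly one $N\in\mathcal N$. Let $\kappa(\mathcal N)$ be the graph on $V$ in which two distinct vertices are adjacent iff some $N\in\mathcal N$ contains both. For a chordal graph $H$ let $\omega(H)$ be the size of its largest clique minus one. There is a constant $K$ (independent of all data, in particular of $V$ and $d$) such that the following holds for all graphs $G_{\mathbb P},G_{\mathbb Q}$ on $V$, all disjoint $Y,Z\subseteq V$, all $\mathcal N$-partitions $\mathcal N_{\mathbb P,Z}$ of $G_{\mathbb P}$ and $\mathcal N_{\mathbb Q,Z}$ of $G_{\mathbb Q}$ for $Z$, and every computation graph $H=\mathcal U(\kappa(\mathcal N_{\mathbb P,Z}),\kappa(\mathcal N_{\mathbb Q,Z}))$, i.e. every chordal graph $H$ on $V$ that contains all edges of $\kappa(\mathcal N_{\mathbb P,Z})$ and $\kappa(\mathcal N_{\mathbb Q,Z})$. There is a straight-line program (each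 step reads an input, writes a rational constant, or applies $+,-,\times,/$ or $\log$ to results of earlier steps, at unit cost over the reals) with at most $$K\cdot |V|^2\cdot d^{\,\omega(H)+1}$$ steps which, for all decomposable models $\mathbb P$ on $G_{\mathbb P}$ and $\mathbb Q$ on $G_{\mathbb Q}$, given the entries of their conditional probability tables as inputs, outputs $D^{(0,0)}_{AB}(\mathbb P_{Y\mid Z}\,\|\,\mathbb Q_{Y\mid Z})$. For binary variables ($d=2$) the bound is $O(|V|^2\cdot 2^{\omega(H)+1})$. -/

import Mathlib

/-! ### Chordal graphs, treewidth, computation graphs -/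

section Graphs

variable {V : Type*}

/-- A graph is chordal if it has no induced cycle of length at least four. -/
def IsChordal (G : SimpleGraph V) : Prop :=
  ∀ m : ℕ, 4 ≤ m → IsEmpty (SimpleGraph.cycleGraph m ↪g G)

/-- The treewidth of a chordal graph: the size of its largest clique, minus one. -/
noncomputable def treewidth (H : SimpleGraph V) : ℕ := H.cliqueNum - 1

/-- `H` is a computation graph of `G₁` and `G₂`: a chordal graph with all edges of both.
All graphs here have the same vertex set, the type `V`. -/
def IsComputationGraph (G₁ G₂ H : SimpleGraph V) : Prop :=
  IsChordal H ∧ G₁ ≤ H ∧ G₂ ≤ H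

/-- The sets-to-cliques graph of a family of vertex sets: two distinct vertices are adjacent iff
some member of the family contains both. -/
def setsToCliques (𝒩 : Finset (Finset V)) : SimpleGraph V where
  Adj u v := u ≠ v ∧ ∃ N ∈ 𝒩, u ∈ N ∧ v ∈ N
  symm := ⟨fun _ _ h => ⟨h.1.symm, h.2.imp fun _ hN => ⟨hN.1, hN.2.2, hN.2.1⟩⟩⟩
  loopless := ⟨fun _ h => h.1 rfl⟩

open Classical in
/-- The maximal cliques of the induced subgraph `G(N)`, as sets of vertices of `G`. -/
noncomputable def maxCliquesIn (G : SimpleGraph V) (N : Finset V) : Finset (Finset V) :=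
  N.powerset.filter fun C => Maximal (fun s : Finset V => s ⊆ N ∧ G.IsClique (s : Set V)) C

/-- The maximal cliques of `G`. -/
noncomputable def maxCliques [Fintype V] (G : SimpleGraph V) : Finset (Finset V) :=
  maxCliquesIn G Finset.univ

/-- The type of maximal cliques of `G`. -/
abbrev MaxClique [Fintype V] (G : SimpleGraph V) : Type _ := {C : Finset V // C ∈ maxCliques G}

/-- `𝒩` is an `𝒩`-partition of `G` for the marginal variables `Z`: the maximal cliques of the
induced subgraphs `G(N)`, `N ∈ 𝒩`, partition the maximal cliques of `G`, and the nonempty sets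
among the `N \ Z`, `N ∈ 𝒩`, partition the complement of `Z`. -/
structure IsNPartition [Fintype V] [DecidableEq V] (G : SimpleGraph V) (Z : Finset V)
    (𝒩 : Finset (Finset V)) : Prop where
  cliques_disjoint : (𝒩 : Set (Finset V)).PairwiseDisjoint (fun N => maxCliquesIn G N)
  cliques_cover : (𝒩.biUnion fun N => maxCliquesIn G N) = maxCliques G
  vars_disjoint : (𝒩 : Set (Finset V)).PairwiseDisjoint (fun N => N \ Z)
  vars_cover : (𝒩.biUnion fun N => N \ Z) = Finset.univ \ Z

/-- A rooted clique tree of `G`: a tree on the maximal cliques of `G` in which, for each vertex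
`v`, the cliques containing `v` induce a connected subtree; with a distinguished root. -/
structure RootedCliqueTree [Fintype V] (G : SimpleGraph V) where
  tree : SimpleGraph (MaxClique G)
  isTree : tree.IsTree
  connected : ∀ v : V, (tree.induce {C : MaxClique G | v ∈ C.1}).Connected
  root : MaxClique G

open Classical in
/-- The separator of `C` and its parent (the neighbour of `C` that is nearer to the root);
empty for the root. -/
noncomputable def RootedCliqueTree.sep [Fintype V] {G : SimpleGraph V} (T : RootedCliqueTree G)
    (C : MaxClique G) : Finset V :=
  C.1.filter fun v =>
    ∃ D : MaxClique G, T.tree.Adj C D ∧ T.tree.dist T.root D < T.tree.dist T.root C ∧ v ∈ D.1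

theorem RootedCliqueTree.sep_subset [Fintype V] {G : SimpleGraph V} (T : RootedCliqueTree G)
    (C : MaxClique G) : T.sep C ⊆ C.1 := by
  classical
  exact Finset.filter_subset _ _

end Graphs

/-! ### Marginals, conditionals and the αβ-divergence -/

section Divergence

variable {V : Type*} [Fintype V] [DecidableEq V]
  {X : V → Type*} [∀ v, Fintype (X v)] [∀ v, DecidableEq (X v)]

/-- The marginal of `p` over the variables in `A`. -/
def marginal (p : (∀ v, X v) → ℝ) (A : Finset V) (a : ∀ v : A, X v) : ℝ :=
  ∑ x : (∀ v, X v) with A.restrict x = a, p x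

/-- The conditional probability `p(y ∣ z)` of the values `y` of the variables in `Y` given the
values `z` of the variables in `Z`. -/
noncomputable def conditional (p : (∀ v, X v) → ℝ) (Y Z : Finset V)
    (z : ∀ v : Z, X v) (y : ∀ v : Y, X v) : ℝ :=
  (∑ x : (∀ v, X v) with Y.restrict x = y ∧ Z.restrict x = z, p x) / marginal p Z z

open Classical in
/-- The pointwise αβ-divergence of two positive numbers. -/
noncomputable def abDivPoint (α β p q : ℝ) : ℝ :=
  if α = 0 ∧ β = 0 then
    1 / 2 * (Real.log p - Real.log q) ^ 2
  else if β = 0 then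
    1 / α ^ 2 * (p ^ α * Real.log (p ^ α / q ^ α) - p ^ α + q ^ α)
  else if α = 0 then
    1 / β ^ 2 * (q ^ β * Real.log (q ^ β / p ^ β) - q ^ β + p ^ β)
  else if α = -β then
    1 / α ^ 2 * (Real.log (q ^ α / p ^ α) + (q ^ α / p ^ α)⁻¹ - 1)
  else
    -1 / (α * β) *
      (p ^ α * q ^ β - α * p ^ (α + β) / (α + β) - β * q ^ (α + β) / (α + β))

/-- The αβ-divergence between two positive measures on a finite set. -/
noncomputable def abDiv {ι : Type*} [Fintype ι] (α β : ℝ) (p q : ι → ℝ) : ℝ :=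
  ∑ i, abDivPoint α β (p i) (q i)

/-- The conditional αβ-divergence: the expectation, over `z` distributed as the marginal `p_Z`, of
the αβ-divergence between `p_{Y∣z}` and `q_{Y∣z}`. -/
noncomputable def condABDiv (α β : ℝ) (p q : (∀ v, X v) → ℝ) (Y Z : Finset V) : ℝ :=
  ∑ z : (∀ v : Z, X v),
    marginal p Z z * abDiv α β (conditional p Y Z z) (conditional q Y Z z)

/-! ### Decomposable models -/

/-- The conditional probability table of the clique `C` in a rooted clique tree:
`p_C(x_C) / p_S(x_S)`, with `S` the separator of `C` and its parent. -/
noncomputable def cliqueCPT {G : SimpleGraph V} (T : RootedCliqueTree G) (p : (∀ v, X v) → ℝ)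
    (C : MaxClique G) (a : ∀ v : C.1, X v) : ℝ :=
  marginal p C.1 a / marginal p (T.sep C) (Finset.restrict₂ (T.sep_subset C) a)

/-- A decomposable model on the graph `G`: a strictly positive probability distribution that is
the product of its conditional probability tables over the cliques of a clique tree of the
chordal graph `G`. -/
structure DecomposableModel (G : SimpleGraph V) (X : V → Type*) [∀ v, Fintype (X v)]
    [∀ v, DecidableEq (X v)] where
  chordal : IsChordal G
  cliqueTree : RootedCliqueTree G
  prob : (∀ v, X v) → ℝ
  prob_pos : ∀ x, 0 < prob x
  prob_sum : ∑ x, prob x = 1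
  factorizes : ∀ x, prob x = ∏ C : MaxClique G, cliqueCPT cliqueTree prob C (C.1.restrict x)

/-- The entries of the conditional probability tables of a decomposable model on `G`: a maximal
clique and values of its variables. -/
abbrev TableEntry (G : SimpleGraph V) (X : V → Type*) : Type _ :=
  Σ C : MaxClique G, (∀ v : C.1, X v)

/-- The conditional probability tables of a decomposable model. -/
noncomputable def DecomposableModel.table {G : SimpleGraph V} (M : DecomposableModel G X)
    (e : TableEntry G X) : ℝ :=
  cliqueCPT M.cliqueTree M.prob e.1 e.2

end Divergence

/-! ### Straight-line programs over the reals, with a step count -/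

/-- One step of a straight-line program: reading one input, writing one rational constant, or one
arithmetic operation or logarithm on the results of the steps with the given numbers. -/
inductive Instr (ι : Type*) where
  | input (i : ι) : Instr ι
  | const (c : ℚ) : Instr ι
  | add (i j : ℕ) : Instr ι
  | sub (i j : ℕ) : Instr ι
  | mul (i j : ℕ) : Instr ι
  | div (i j : ℕ) : Instr ι
  | log (i : ℕ) : Instr ι

/-- The result of one step, given the list of the results of the earlier steps. -/
noncomputable def Instr.eval {ι : Type*} (inp : ι → ℝ) (r : List ℝ) : Instr ι → ℝ
  | .input i => inp i
  | .const c => (c : ℝ)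
  | .add i j => r.getD i 0 + r.getD j 0
  | .sub i j => r.getD i 0 - r.getD j 0
  | .mul i j => r.getD i 0 * r.getD j 0
  | .div i j => r.getD i 0 / r.getD j 0
  | .log i => Real.log (r.getD i 0)

/-- A straight-line program, the list of its steps. -/
abbrev SLP (ι : Type*) : Type _ := List (Instr ι)

/-- The running time of a straight-line program: every step, whether it reads an input, writes a
constant or does an operation, costs one unit. -/
def SLP.steps {ι : Type*} (prog : SLP ι) : ℕ := prog.length

/-- The results of all steps, in order, on the input `inp`. -/
noncomputable def SLP.run {ι : Type*} (prog : SLP ι) (inp : ι → ℝ) : List ℝ :=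
  prog.foldl (fun r s => r ++ [s.eval inp r]) []

/-- The output of a straight-line program: the result of its last step. -/
noncomputable def SLP.output {ι : Type*} (prog : SLP ι) (inp : ι → ℝ) : ℝ :=
  (prog.run inp).getLastD 0

/-!
The divergence is computed by one run of variable elimination over the ring `ℝ[ε, δ]` with
`ε² = δ² = 0`, along the computation graph `H`.

Every part `N` of an `𝒩`-partition is a clique of `H`. A variable outside `Z` lies in one part only,
so that for `U ⊇ Z` the variables outside `U` are summed out of the product of all tables part by
part, and the marginal over `U` is a product of functions of the single parts
(`sumOut_compl_eq_prod_partMarginal`). With `U = Z` and `U = Y ∪ Z` this makes `P_Z` a product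
`∏ N, w_N`, and `log P(y ∣ z) - log Q(y ∣ z)` a sum `∑ i, g_i` over the parts of both partitions
(`log_div_eq_sum_partLogRatio`). All these functions have scopes that are cliques of `H`, and the
tables of their values are found directly.

It remains to sum `P_Z (∑ i, g_i)²` over all assignments. Expanding the square would require an
elimination for each pair of terms. Instead, a product of elements `(1 + g ε)(1 + g δ)` is again of
this form, with the sum of the exponents `g`, so that the product of the factors `w_N (1 + g_N ε)(1 + g_N δ)` has the coefficient
`P_Z (∑ i, g_i)²` at `ε δ` (`BiDual.prod_twist`): a single sum of a product of `O(|V|)` factors in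
`ℝ[ε, δ]` is needed.

A chordal graph has a simplicial vertex in every nonempty set of vertices
(`IsChordal.exists_isClique_neighbors`). Eliminating the variables in such an order keeps all scopes
cliques of `H`, and since each factor is used only once the sum takes `O(|V| D)` steps, where `D`
bounds the number of assignments to a clique of `H` (`Derivable.sum_prod`). The same fact bounds the
number of maximal cliques of the chordal graphs of the models by `|V| + 1`
(`IsChordal.card_maxCliquesIn_le`), and hence the number of parts and the size of the input. The
total is in fact linear in `|V|`. If one of the graphs carries no models, for instance because it is not
chordal, the claim about the output is void and the empty program will do.

Costs are tracked by the relation `Derivable inp A B k`: a program that has computed the functions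
in `A` computes those in `B` in at most `k` further steps.
-/

/-! ### Families of functions computed by straight-line programs -/

section StraightLine

variable {ι Ω : Type*} {inp : Ω → ι → ℝ}

theorem SLP.run_append_singleton (prog : SLP ι) (s : Instr ι) (x : ι → ℝ) :
    SLP.run (prog ++ [s]) x = prog.run x ++ [s.eval x (prog.run x)] := by
  simp [SLP.run, List.foldl_append]

theorem SLP.length_run (prog : SLP ι) (x : ι → ℝ) : (prog.run x).length = prog.length := by
  induction prog using List.reverseRecOn with
  | nil => rfl
  | append_singleton l s ih => rw [SLP.run_append_singleton]; simp [ih]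

/-- On each of the inputs `inp ω`, the program `prog` computes all functions of `ω` in the family
`A`, each as the result of a step whose number does not depend on `ω`. -/
def Computes (inp : Ω → ι → ℝ) (prog : SLP ι) (A : Set (Ω → ℝ)) : Prop :=
  ∀ f ∈ A, ∃ i < prog.length, ∀ ω, (prog.run (inp ω)).getD i 0 = f ω

/-- From the functions in `A` those in `B` are computed in at most `k` further steps: every
program that computes `A` extends by at most `k` steps to one that also computes `B`. -/
def Derivable (inp : Ω → ι → ℝ) (A B : Set (Ω → ℝ)) (k : ℕ) : Prop :=
  ∀ prog, Computes inp prog A →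
    ∃ ext : SLP ι, ext.length ≤ k ∧ Computes inp (prog ++ ext) B

theorem Computes.append {prog : SLP ι} {A : Set (Ω → ℝ)} (h : Computes inp prog A)
    (ext : SLP ι) : Computes inp (prog ++ ext) A := by
  induction ext using List.reverseRecOn with
  | nil => simpa using h
  | append_singleton l s ih =>
    intro f hf
    obtain ⟨i, hi, hv⟩ := ih f hf
    refine ⟨i, by simp only [List.length_append] at hi ⊢; omega, fun ω => ?_⟩
    rw [← List.append_assoc, SLP.run_append_singleton, List.getD_append _ _ _ _ ?_, hv ω]
    rwa [SLP.length_run]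

theorem Computes.mono {prog : SLP ι} {A B : Set (Ω → ℝ)} (h : Computes inp prog B)
    (hAB : A ⊆ B) : Computes inp prog A := fun f hf => h f (hAB hf)

theorem Computes.union {prog : SLP ι} {A B : Set (Ω → ℝ)} (hA : Computes inp prog A)
    (hB : Computes inp prog B) : Computes inp prog (A ∪ B) := by
  rintro f (hf | hf)
  exacts [hA f hf, hB f hf]

namespace Derivable

variable {A A' B B' C : Set (Ω → ℝ)} {f g : Ω → ℝ} {k l : ℕ}

theorem mono (h : Derivable inp A B k) (hA : A ⊆ A') (hB : B' ⊆ B) (hk : k ≤ l) :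
    Derivable inp A' B' l := fun prog hp => by
  obtain ⟨ext, hl, he⟩ := h prog (hp.mono hA)
  exact ⟨ext, hl.trans hk, he.mono hB⟩

theorem mono_cost (h : Derivable inp A B k) (hk : k ≤ l) : Derivable inp A B l :=
  h.mono subset_rfl subset_rfl hk

theorem mono_left (h : Derivable inp A B k) (hA : A ⊆ A') : Derivable inp A' B k :=
  h.mono hA subset_rfl le_rfl

theorem mono_right (h : Derivable inp A B k) (hB : B' ⊆ B) : Derivable inp A B' k :=
  h.mono subset_rfl hB le_rfl

theorem of_subset (h : B ⊆ A) : Derivable inp A B 0 := fun prog hp =>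
  ⟨[], by simp, by simpa using hp.mono h⟩

theorem of_mem (h : f ∈ A) : Derivable inp A {f} 0 := of_subset (by simpa using h)

/-- Composition of computations; the functions already computed stay available. -/
theorem trans (h : Derivable inp A B k) (h' : Derivable inp (A ∪ B) C l) :
    Derivable inp A C (k + l) := fun prog hp => by
  obtain ⟨e, hl, he⟩ := h prog hp
  obtain ⟨e', hl', he'⟩ := h' _ ((hp.append e).union he)
  refine ⟨e ++ e', by simp only [List.length_append]; omega, ?_⟩
  rwa [← List.append_assoc]

theorem union (h : Derivable inp A B k) (h' : Derivable inp A C l) :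
    Derivable inp A (B ∪ C) (k + l) := fun prog hp => by
  obtain ⟨e, hl, he⟩ := h prog hp
  obtain ⟨e', hl', he'⟩ := h' _ (hp.append e)
  refine ⟨e ++ e', by simp only [List.length_append]; omega, ?_⟩
  rw [← List.append_assoc]
  exact (he.append _).union he'

theorem biUnion {α : Type*} (s : Finset α) {B : α → Set (Ω → ℝ)} {k : α → ℕ}
    (h : ∀ i ∈ s, Derivable inp A (B i) (k i)) :
    Derivable inp A (⋃ i ∈ s, B i) (∑ i ∈ s, k i) := by
  classical
  induction s using Finset.induction_on with
  | empty => exact of_subset (by simp)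
  | insert a s ha ih =>
    rw [Finset.sum_insert ha, Finset.set_biUnion_insert]
    exact (h a (by simp)).union (ih fun i hi => h i (by simp [hi]))

theorem biUnion_const {α : Type*} (s : Finset α) {B : α → Set (Ω → ℝ)}
    (h : ∀ i ∈ s, Derivable inp A (B i) k) :
    Derivable inp A (⋃ i ∈ s, B i) (s.card * k) :=
  (biUnion s h).mono_cost (by simp)

theorem of_instr (h : ∀ prog, Computes inp prog A →
    ∃ s : Instr ι, ∀ ω, s.eval (inp ω) (prog.run (inp ω)) = f ω) : Derivable inp A {f} 1 := by
  intro prog hp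
  obtain ⟨s, hs⟩ := h prog hp
  refine ⟨[s], le_rfl, ?_⟩
  rintro _ rfl
  refine ⟨prog.length, by simp, fun ω => ?_⟩
  rw [SLP.run_append_singleton, List.getD_append_right _ _ _ _ (by rw [SLP.length_run])]
  simp [SLP.length_run, hs]

theorem input (i : ι) : Derivable inp A {fun ω => inp ω i} 1 :=
  of_instr fun _ _ => ⟨.input i, fun _ => rfl⟩

theorem const (c : ℚ) : Derivable inp A {fun _ => (c : ℝ)} 1 :=
  of_instr fun _ _ => ⟨.const c, fun _ => rfl⟩

theorem of_binary (op : ℕ → ℕ → Instr ι) (F : ℝ → ℝ → ℝ)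
    (hop : ∀ i j x r, (op i j).eval x r = F (r.getD i 0) (r.getD j 0))
    (hf : Derivable inp A {f} k) (hg : Derivable inp A {g} l) :
    Derivable inp A {fun ω => F (f ω) (g ω)} (k + l + 1) := by
  refine (hf.union hg).trans (of_instr fun prog hp => ?_)
  obtain ⟨i, -, hi⟩ := hp f (by simp)
  obtain ⟨j, -, hj⟩ := hp g (by simp)
  exact ⟨op i j, fun ω => by rw [hop, hi, hj]⟩

theorem add (hf : Derivable inp A {f} k) (hg : Derivable inp A {g} l) :
    Derivable inp A {fun ω => f ω + g ω} (k + l + 1) :=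
  of_binary .add (· + ·) (fun _ _ _ _ => rfl) hf hg

theorem sub (hf : Derivable inp A {f} k) (hg : Derivable inp A {g} l) :
    Derivable inp A {fun ω => f ω - g ω} (k + l + 1) :=
  of_binary .sub (· - ·) (fun _ _ _ _ => rfl) hf hg

theorem mul (hf : Derivable inp A {f} k) (hg : Derivable inp A {g} l) :
    Derivable inp A {fun ω => f ω * g ω} (k + l + 1) :=
  of_binary .mul (· * ·) (fun _ _ _ _ => rfl) hf hg

theorem log (hf : Derivable inp A {f} k) :
    Derivable inp A {fun ω => Real.log (f ω)} (k + 1) := by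
  refine hf.trans (of_instr fun prog hp => ?_)
  obtain ⟨i, -, hi⟩ := hp f (by simp)
  exact ⟨.log i, fun ω => by rw [← hi]; rfl⟩

/-- The cost of a product in a commutative monoid whose elements are encoded by families of
functions, from the costs `u` of the unit and `c` of a single multiplication. -/
@[to_additive /-- The cost of a sum in a commutative additive monoid whose elements are encoded
by families of functions, from the costs `u` of zero and `c` of a single addition. -/]
theorem multiset_prod {β α : Type*} [CommMonoid β] {enc : β → Set (Ω → ℝ)} {c u : ℕ}
    (hone : Derivable inp A (enc 1) u)
    (hmul : ∀ a b, Derivable inp (enc a ∪ enc b) (enc (a * b)) c)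
    (F : α → β) (M : Multiset α) (hF : ∀ i ∈ M, enc (F i) ⊆ A) :
    Derivable inp A (enc (M.map F).prod) (c * M.card + u) := by
  induction M using Multiset.induction_on with
  | empty => simpa using hone
  | cons a M ih =>
    rw [Multiset.map_cons, Multiset.prod_cons, Multiset.card_cons]
    refine ((ih fun i hi => hF i (by simp [hi])).trans ((hmul _ _).mono_left ?_)).mono_cost
      (l := c * (M.card + 1) + u) (by rw [mul_add]; omega)
    exact Set.union_subset_union_left _ (hF a (by simp))

/-- A program whose last step is the result wanted. -/
theorem exists_output (h : Derivable inp ∅ {f} k) :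
    ∃ prog : SLP ι, prog.steps ≤ k + 1 ∧ ∀ ω, prog.output (inp ω) = f ω := by
  obtain ⟨e, hl, he⟩ := h [] (by rintro f ⟨⟩)
  obtain ⟨i, -, hi⟩ := he f rfl
  -- Outside the list of results `getD` returns zero, so this step copies the result of step `i`.
  refine ⟨e ++ [.add i e.length], by simpa [SLP.steps] using hl, fun ω => ?_⟩
  rw [SLP.output, SLP.run_append_singleton, List.getLastD_concat]
  have : (SLP.run e (inp ω)).getD e.length 0 = 0 :=
    List.getD_eq_default _ _ (by rw [SLP.length_run])
  have hi := hi ω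
  simp only [List.nil_append] at hi
  simp only [Instr.eval, this, hi, add_zero]

end Derivable

end StraightLine

/-! ### Simplicial vertices of chordal graphs -/

section Chordal

variable {V : Type*}

/-- If a vertex `d` outside `W` has exactly two neighbours `c` and `c'` in `W`, and these are joined
by a path in `W`, then they are adjacent: otherwise a shortest such path, closed by `d`, is an
induced cycle of length at least four. -/
theorem IsChordal.adj_of_reachable {H : SimpleGraph V} (hH : IsChordal H) {W : Set V} {c c' : W}
    {d : V} (hr : (H.induce W).Reachable c c') (hne : c ≠ c')
    (hd : ∀ w : W, H.Adj d w ↔ w = c ∨ w = c') (hdW : d ∉ W) : H.Adj c c' := by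
  by_contra hadj
  obtain ⟨p, hp⟩ := hr.exists_walk_length_eq_dist
  set L := p.length with hL
  have h1 : ∀ i ≤ L, (H.induce W).dist c (p.getVert i) = i := by
    intro i hi
    have a1 := SimpleGraph.dist_le (p.take i)
    have a2 := SimpleGraph.dist_le (p.drop i)
    have a3 : (H.induce W).dist c c' ≤
        (H.induce W).dist c (p.getVert i) + (H.induce W).dist (p.getVert i) c' :=
      (p.take i).reachable.dist_triangle_left _
    rw [SimpleGraph.Walk.take_length] at a1
    rw [SimpleGraph.Walk.drop_length] at a2
    omega
  have hinj : ∀ i ≤ L, ∀ j ≤ L, p.getVert i = p.getVert j → i = j := by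
    intro i hi j hj h
    rw [← h1 i hi, ← h1 j hj, h]
  have hstep : ∀ i ≤ L, ∀ j ≤ L,
      (H.Adj (p.getVert i) (p.getVert j) ↔ i + 1 = j ∨ j + 1 = i) := by
    intro i hi j hj
    constructor
    · intro h
      have hij : i ≠ j := by rintro rfl; exact h.ne rfl
      have h' : (H.induce W).Adj (p.getVert i) (p.getVert j) := h
      have := h'.diff_dist_adj (u := c)
      rw [h1 i hi, h1 j hj] at this
      omega
    · rintro (rfl | rfl)
      · exact p.adj_getVert_succ (i := i) (by omega)
      · exact (p.adj_getVert_succ (i := j) (by omega)).symm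
  have hL2 : 2 ≤ L := by
    by_contra hlt
    have : L = 0 ∨ L = 1 := by omega
    rcases this with h | h
    · exact hne (SimpleGraph.Walk.eq_of_length_eq_zero h)
    · have hcc : (H.induce W).Adj c c' := SimpleGraph.Walk.adj_of_length_eq_one (hL ▸ h)
      exact hadj hcc
  have hdp : ∀ i ≤ L, (H.Adj d (p.getVert i) ↔ i = 0 ∨ i = L) := by
    intro i hi
    rw [hd]
    refine or_congr ⟨fun h => hinj i hi 0 (by omega) (by simpa using h), ?_⟩
      ⟨fun h => hinj i hi L le_rfl (by simpa [hL] using h), ?_⟩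
    · rintro rfl; simp
    · rintro rfl; simp [hL]
  refine (hH (L + 2) (by omega)).false
    ⟨⟨fun i => if i.val ≤ L then (p.getVert i.val : V) else d, ?_⟩, ?_⟩
  · intro i j h
    have hi := i.isLt
    have hj := j.isLt
    simp only at h
    apply Fin.ext
    split_ifs at h with ha hb hb
    · exact hinj _ ha _ hb (Subtype.ext h)
    · exact (hdW (h ▸ (p.getVert i.val).2)).elim
    · exact (hdW (h ▸ (p.getVert j.val).2)).elim
    · omega
  · intro i j
    have hi := i.isLt
    have hj := j.isLt
    rw [SimpleGraph.cycleGraph_adj', Fin.sub_def, Fin.sub_def]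
    have key : ∀ a b : ℕ, a < L + 2 → b < L + 2 →
        ((L + 2 - b + a) % (L + 2) = 1 ↔ a = b + 1 ∨ a = 0 ∧ b = L + 1) := by
      intro a b ha hb
      rcases le_or_gt b a with h | h
      · rw [show L + 2 - b + a = (a - b) + (L + 2) by omega, Nat.add_mod_right,
          Nat.mod_eq_of_lt (by omega)]
        omega
      · rw [Nat.mod_eq_of_lt (by omega)]
        omega
    rw [key _ _ hi hj, key _ _ hj hi]
    change H.Adj (if i.val ≤ L then _ else d) (if j.val ≤ L then _ else d) ↔ _
    split_ifs with ha hb hb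
    · rw [hstep _ ha _ hb]; omega
    · rw [H.adj_comm, hdp _ ha]; omega
    · rw [hdp _ hb]; omega
    · exact iff_of_false (fun h => h.ne rfl) (by omega)

/-- Every nonempty set of vertices of a chordal graph contains a vertex that is simplicial in the
subgraph it induces. The proof takes a maximal connected subset `B` whose closed neighbourhood is
not everything. The boundary `C` of `B` is then completely joined to the rest `D`, so that it is a
clique, and a simplicial vertex of `D` is simplicial. -/
theorem IsChordal.exists_isClique_neighbors {H : SimpleGraph V} (hH : IsChordal H)
    (U : Finset V) (hU : U.Nonempty) : ∃ v ∈ U, H.IsClique {w | w ∈ U ∧ H.Adj v w} := by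
  classical
  induction U using Finset.strongInduction with
  | H U ih =>
    let good : Finset V → Prop := fun B =>
      (H.induce (B : Set V)).Connected ∧ ∃ d ∈ U, d ∉ B ∧ ∀ b ∈ B, ¬ H.Adj b d
    by_cases hex : ∃ B ∈ U.powerset, good B
    swap
    · -- No such set: already the singletons fail, so that the whole of `U` is a clique.
      obtain ⟨v, hv⟩ := hU
      refine ⟨v, hv, fun a ha b hb hab => ?_⟩
      by_contra hadj
      refine hex ⟨{a}, by simpa using ha.1, ?_, b, hb.1, by simpa using hab.symm, by simpa⟩
      rw [Finset.coe_singleton]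
      exact SimpleGraph.connected_iff_exists_forall_reachable _ |>.2
        ⟨⟨a, rfl⟩, by rintro ⟨w, rfl⟩; rfl⟩
    · obtain ⟨B, hBm, hmax⟩ := Finset.exists_max_image (U.powerset.filter good) Finset.card
        (by obtain ⟨B, h1, h2⟩ := hex; exact ⟨B, by simp only [Finset.mem_filter]; exact ⟨h1, h2⟩⟩)
      simp only [Finset.mem_filter, Finset.mem_powerset] at hBm hmax
      obtain ⟨hBU, hBc, hBd⟩ := hBm
      let D := U.filter fun d => d ∉ B ∧ ∀ b ∈ B, ¬ H.Adj b d
      have hDne : D.Nonempty := by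
        obtain ⟨d, h1, h2⟩ := hBd
        exact ⟨d, by simp only [D, Finset.mem_filter]; exact ⟨h1, h2⟩⟩
      obtain ⟨b₀, hb₀⟩ : B.Nonempty := by
        obtain ⟨x⟩ := hBc.nonempty
        exact ⟨x.1, x.2⟩
      have hDU : D ⊂ U := by
        refine ⟨Finset.filter_subset _ _, fun h => ?_⟩
        have := h (hBU hb₀)
        simp only [D, Finset.mem_filter] at this
        exact this.2.1 hb₀
      have hins : ∀ c ∈ U, ∀ b ∈ B, H.Adj b c →
          (H.induce (insert c (B : Set V))).Connected := by
        intro c hc b hb hbc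
        have := SimpleGraph.induce_union_connected (G := H) (s := {b, c}) (t := (B : Set V))
          (SimpleGraph.induce_pair_connected_of_adj hbc).preconnected hBc.preconnected
          ⟨b, by simp, hb⟩
        have he : ({b, c} ∪ B : Set V) = insert c (B : Set V) := by
          ext x
          simp only [Set.mem_union, Set.mem_insert_iff, Set.mem_singleton_iff, Finset.mem_coe]
          constructor
          · rintro ((rfl | h) | h)
            exacts [Or.inr hb, Or.inl h, Or.inr h]
          · rintro (h | h)
            exacts [Or.inl (Or.inr h), Or.inr h]
        rwa [he] at this
      -- By maximality of `B`, each boundary vertex is adjacent to all of `D`.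
      have hCD : ∀ c ∈ U, c ∉ B → ∀ b ∈ B, H.Adj b c → ∀ d ∈ D, H.Adj c d := by
        intro c hc hcB b hb hbc d hd
        simp only [D, Finset.mem_filter] at hd
        by_contra hadj
        have := hmax (insert c B) ⟨Finset.insert_subset hc hBU, ?_, d, hd.1, ?_, ?_⟩
        · rw [Finset.card_insert_of_notMem hcB] at this; omega
        · rw [Finset.coe_insert]; exact hins c hc b hb hbc
        · simp only [Finset.mem_insert, not_or]
          refine ⟨?_, hd.2.1⟩
          rintro rfl
          exact hd.2.2 b hb hbc
        · simp only [Finset.mem_insert, forall_eq_or_imp]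
          exact ⟨hadj, hd.2.2⟩
      obtain ⟨v, hvD, hv⟩ := ih D hDU hDne
      have hvD' := hvD
      simp only [D, Finset.mem_filter] at hvD'
      -- A neighbour of `v` outside `D` lies in the boundary of `B`.
      have hout : ∀ w ∈ U, H.Adj v w → w ∉ D → w ∉ B ∧ ∃ b ∈ B, H.Adj b w := by
        intro w hw hvw hwD
        have hwB : w ∉ B := fun h => hvD'.2.2 w h hvw.symm
        refine ⟨hwB, ?_⟩
        by_contra hno
        push Not at hno
        exact hwD (by simp only [D, Finset.mem_filter]; exact ⟨hw, hwB, hno⟩)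
      refine ⟨v, hvD'.1, fun a ⟨ha, hva⟩ b ⟨hb, hvb⟩ hab => ?_⟩
      by_cases haD : a ∈ D
      · by_cases hbD : b ∈ D
        · exact hv ⟨haD, hva⟩ ⟨hbD, hvb⟩ hab
        · obtain ⟨h1, x, hx, hxb⟩ := hout b hb hvb hbD
          exact (hCD b hb h1 x hx hxb a haD).symm
      · obtain ⟨h1, x, hx, hxa⟩ := hout a ha hva haD
        by_cases hbD : b ∈ D
        · exact hCD a ha h1 x hx hxa b hbD
        · obtain ⟨h2, y, hy, hyb⟩ := hout b hb hvb hbD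
          have hc1 := hins a ha x hx hxa
          have hc2 := hins b hb y hy hyb
          have hconn := SimpleGraph.induce_union_connected (G := H) hc1.preconnected
            hc2.preconnected ⟨x, by simp [hx], by simp [hx]⟩
          refine hH.adj_of_reachable (W := insert a (B : Set V) ∪ insert b (B : Set V))
            (c := ⟨a, by simp⟩) (c' := ⟨b, by simp⟩) (d := v) (hconn.preconnected _ _) ?_ ?_ ?_
          · simpa using hab
          · rintro ⟨w, hw⟩
            simp only [Subtype.mk.injEq]
            constructor
            · intro h
              simp only [Set.mem_union, Set.mem_insert_iff, Finset.mem_coe] at hw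
              have : w ∉ B := fun hwB => hvD'.2.2 w hwB h.symm
              tauto
            · rintro (rfl | rfl)
              exacts [hva, hvb]
          · simp only [Set.mem_union, Set.mem_insert_iff, Finset.mem_coe, not_or]
            exact ⟨⟨hva.ne, hvD'.2.1⟩, hvb.ne, hvD'.2.1⟩

/-- A chordal graph has few maximal cliques: only one of them contains a given simplicial vertex,
and the others stay maximal when that vertex is deleted. -/
theorem IsChordal.card_maxCliquesIn_le {H : SimpleGraph V} (hH : IsChordal H) (U : Finset V) :
    (maxCliquesIn H U).card ≤ U.card + 1 := by
  classical
  induction hn : U.card generalizing U with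
  | zero =>
    rw [Finset.card_eq_zero] at hn
    subst hn
    exact (Finset.card_filter_le _ _).trans (by simp)
  | succ n ih =>
    obtain ⟨v, hv, hcl⟩ := hH.exists_isClique_neighbors U (Finset.card_pos.1 (by omega))
    have hcl' : H.IsClique (insert v {w | w ∈ U ∧ H.Adj v w} : Set V) :=
      hcl.insert fun b hb _ => hb.2
    have hsub : maxCliquesIn H U ⊆
        insert (U.filter fun w => w = v ∨ H.Adj v w) (maxCliquesIn H (U.erase v)) := by
      intro C hC
      simp only [maxCliquesIn, Finset.mem_filter, Finset.mem_powerset, Finset.mem_insert] at hC ⊢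
      obtain ⟨hCU, hm⟩ := hC
      by_cases hvC : v ∈ C
      · left
        have hle : C ⊆ U.filter fun w => w = v ∨ H.Adj v w := by
          intro w hw
          simp only [Finset.mem_filter]
          refine ⟨hCU hw, ?_⟩
          by_cases hwv : w = v
          · exact Or.inl hwv
          · exact Or.inr (hm.1.2 hvC hw (Ne.symm hwv))
        refine subset_antisymm hle (hm.2 ⟨Finset.filter_subset _ _, hcl'.subset ?_⟩ hle)
        intro w
        simp only [Finset.coe_filter, Set.mem_ofPred_eq, Set.mem_insert_iff]
        tauto
      · right
        have h1 : C ⊆ U.erase v := fun w hw =>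
          Finset.mem_erase.2 ⟨fun h => hvC (h ▸ hw), hCU hw⟩
        exact ⟨h1, ⟨h1, hm.1.2⟩, fun s hs hCs =>
          hm.2 ⟨hs.1.trans (Finset.erase_subset _ _), hs.2⟩ hCs⟩
    refine (Finset.card_le_card hsub).trans ((Finset.card_insert_le _ _).trans ?_)
    have := ih (U.erase v) (by rw [Finset.card_erase_of_mem hv]; omega)
    omega

end Chordal

/-! ### Summing out variables -/

section SumOut

variable {V : Type*} {X : V → Type*} [∀ v, Fintype (X v)]

theorem card_pos_of_nonempty_pi [∀ v, Nonempty (X v)] (S : Finset V) :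
    0 < ∏ v ∈ S, Fintype.card (X v) :=
  Finset.prod_pos fun _ _ => Fintype.card_pos

variable [Fintype V] [DecidableEq V]

/-- The assignments that agree with `x` outside `W`. -/
def agreeOff (W : Finset V) (x : ∀ v, X v) : Finset (∀ v, X v) :=
  Fintype.piFinset fun v => if v ∈ W then Finset.univ else {x v}

theorem mem_agreeOff {W : Finset V} {x y : ∀ v, X v} :
    y ∈ agreeOff W x ↔ ∀ v ∉ W, y v = x v := by
  simp only [agreeOff, Fintype.mem_piFinset]
  refine forall_congr' fun v => ?_
  by_cases h : v ∈ W <;> simp [h]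

theorem card_agreeOff (W : Finset V) (x : ∀ v, X v) :
    (agreeOff W x).card = ∏ v ∈ W, Fintype.card (X v) := by
  rw [agreeOff, Fintype.card_piFinset, ← Finset.prod_subset (Finset.subset_univ W)]
  · exact Finset.prod_congr rfl fun v hv => by simp [hv]
  · intro v _ hv; simp [hv]

/-- The function `F` with the variables in `W` summed out, as a function of all variables. -/
def sumOut {β : Type*} [AddCommMonoid β] (W : Finset V) (F : (∀ v, X v) → β) (x : ∀ v, X v) : β :=
  ∑ y ∈ agreeOff W x, F y

theorem DependsOn.sumOut {β : Type*} [AddCommMonoid β] {F : (∀ v, X v) → β} {S : Finset V}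
    (hF : DependsOn F S) (W : Finset V) : DependsOn (sumOut W F) (S \ W : Finset V) := by
  intro x y hxy
  refine Finset.sum_nbij' (fun z => W.piecewise z y) (fun z => W.piecewise z x) ?_ ?_ ?_ ?_ ?_
  · intro z _
    rw [mem_agreeOff]
    intro v hv
    simp [hv]
  · intro z _
    rw [mem_agreeOff]
    intro v hv
    simp [hv]
  · intro z hz
    rw [mem_agreeOff] at hz
    ext v
    by_cases hv : v ∈ W <;> simp [hv]
    exact (hz v hv).symm
  · intro z hz
    rw [mem_agreeOff] at hz
    ext v
    by_cases hv : v ∈ W <;> simp [hv]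
    exact (hz v hv).symm
  · intro z hz
    rw [mem_agreeOff] at hz
    refine hF fun v hvS => ?_
    by_cases hv : v ∈ W
    · simp [hv]
    · simp only [hv, not_false_eq_true, Finset.piecewise_eq_of_notMem]
      rw [hz v hv]
      exact hxy v (by simpa [hv] using hvS)

theorem sumOut_mul_sumOut {β : Type*} [CommSemiring β] {F G : (∀ v, X v) → β} {W₁ W₂ : Finset V}
    (hd : Disjoint W₁ W₂) (hF : DependsOn F (W₂ : Set V)ᶜ) (hG : DependsOn G (W₁ : Set V)ᶜ)
    (x : ∀ v, X v) :
    sumOut (W₁ ∪ W₂) (fun y => F y * G y) x = sumOut W₁ F x * sumOut W₂ G x := by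
  have hd' : ∀ v ∈ W₁, v ∉ W₂ := fun v h1 h2 => Finset.disjoint_left.1 hd h1 h2
  rw [sumOut, sumOut, sumOut, Finset.sum_mul_sum, ← Finset.sum_product']
  refine Finset.sum_nbij' (fun z => (W₁.piecewise z x, W₂.piecewise z x))
    (fun p => W₁.piecewise p.1 p.2) ?_ ?_ ?_ ?_ ?_
  · intro z _
    rw [Finset.mem_product, mem_agreeOff, mem_agreeOff]
    constructor <;> intro v hv <;> simp [hv]
  · rintro ⟨a, b⟩ hp
    rw [Finset.mem_product, mem_agreeOff, mem_agreeOff] at hp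
    rw [mem_agreeOff]
    intro v hv
    rw [Finset.mem_union, not_or] at hv
    simpa [hv.1] using hp.2 v hv.2
  · intro z hz
    rw [mem_agreeOff] at hz
    ext v
    by_cases h1 : v ∈ W₁
    · simp [h1]
    · by_cases h2 : v ∈ W₂
      · simp [h1, h2]
      · simpa [h1, h2] using (hz v (by simp [h1, h2])).symm
  · rintro ⟨a, b⟩ hp
    rw [Finset.mem_product, mem_agreeOff, mem_agreeOff] at hp
    refine Prod.ext ?_ ?_ <;> ext v
    · by_cases h1 : v ∈ W₁
      · simp [h1]
      · simpa [h1] using (hp.1 v h1).symm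
    · by_cases h2 : v ∈ W₂
      · have h1 : v ∉ W₁ := fun h => hd' v h h2
        simp [h1, h2]
      · simpa [h2] using (hp.2 v h2).symm
  · intro z hz
    rw [mem_agreeOff] at hz
    congr 1
    · refine hF fun v hv => ?_
      have h2 : v ∉ W₂ := hv
      by_cases h1 : v ∈ W₁
      · simp [h1]
      · simpa [h1] using hz v (by simp [h1, h2])
    · refine hG fun v hv => ?_
      have h1 : v ∉ W₁ := hv
      by_cases h2 : v ∈ W₂
      · simp [h2]
      · simpa [h2] using hz v (by simp [h1, h2])

theorem sumOut_mul_right {β : Type*} [CommSemiring β] {F G : (∀ v, X v) → β} {W : Finset V}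
    (hG : DependsOn G (W : Set V)ᶜ) (x : ∀ v, X v) :
    sumOut W (fun y => F y * G y) x = sumOut W F x * G x := by
  rw [sumOut, sumOut, Finset.sum_mul]
  exact Finset.sum_congr rfl fun y hy => by
    rw [hG (x := y) (y := x) fun v hv => mem_agreeOff.1 hy v hv]

theorem DependsOn.finset_prod {α β γ : Type*} {ι : α → Type*} [CommMonoid β] {s : Finset γ}
    {F : γ → (∀ a, ι a) → β} {S : Set α} (h : ∀ i ∈ s, DependsOn (F i) S) :
    DependsOn (fun x => ∏ i ∈ s, F i x) S :=
  fun _ _ hxy => Finset.prod_congr rfl fun i hi => h i hi hxy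

/-- If the scopes `N` of the factors overlap only outside `W`, then the variables in `W` are summed
out of a product factor by factor. -/
theorem sumOut_prod {β : Type*} [CommSemiring β] (W : Finset V) (s : Finset (Finset V))
    (F : Finset V → (∀ v, X v) → β) (hF : ∀ N ∈ s, DependsOn (F N) N)
    (hd : (s : Set (Finset V)).PairwiseDisjoint fun N => N ∩ W) (x : ∀ v, X v) :
    sumOut (s.biUnion fun N => N ∩ W) (fun y => ∏ N ∈ s, F N y) x =
      ∏ N ∈ s, sumOut (N ∩ W) (F N) x := by
  induction s using Finset.induction_on with
  | empty => simp [sumOut, card_agreeOff]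
  | insert N s hN ih =>
    have hd' : ∀ N' ∈ s, Disjoint (N ∩ W) (N' ∩ W) := fun N' hN' =>
      hd (by simp) (by simp [hN']) (by rintro rfl; exact hN hN')
    simp only [Finset.prod_insert hN, Finset.biUnion_insert]
    rw [sumOut_mul_sumOut, ih]
    · exact fun N' hN' => hF N' (by simp [hN'])
    · exact hd.subset (by simp)
    · rw [Finset.disjoint_biUnion_right]
      exact hd'
    · refine (hF N (by simp)).mono fun v hv h => ?_
      simp only [Finset.mem_coe, Finset.mem_biUnion] at h hv
      obtain ⟨N', hN', hvN'⟩ := h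
      exact Finset.disjoint_left.1 (hd' N' hN')
        (Finset.mem_inter.2 ⟨hv, (Finset.mem_inter.1 hvN').2⟩) hvN'
    · refine DependsOn.finset_prod fun N' hN' => (hF N' (by simp [hN'])).mono fun v hv h => ?_
      simp only [Finset.mem_coe] at h hv
      exact Finset.disjoint_left.1 (hd' N' hN') h
        (Finset.mem_inter.2 ⟨hv, (Finset.mem_inter.1 h).2⟩)

theorem sum_sumOut {β : Type*} [AddCommMonoid β] (W : Finset V) (F : (∀ v, X v) → β) :
    ∑ x, sumOut W F x = (∏ v ∈ W, Fintype.card (X v)) • ∑ x, F x := by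
  have hsymm : ∀ x y : ∀ v, X v, y ∈ agreeOff W x ↔ x ∈ agreeOff W y := fun x y => by
    simp only [mem_agreeOff, eq_comm]
  simp only [sumOut]
  rw [Finset.sum_comm' (t' := Finset.univ) (s' := fun y => agreeOff W y)
    (by intro x y; simp [hsymm x y]), Finset.smul_sum]
  exact Finset.sum_congr rfl fun y _ => by rw [Finset.sum_const, card_agreeOff]

section Cost

variable {ι Ω : Type*} {inp : Ω → ι → ℝ} {A : Set (Ω → ℝ)}

/-- A table of the values of a function of the variables in `S` has one entry for each
assignment to these variables. -/
theorem Derivable.iUnion_of_dependsOn [∀ v, Nonempty (X v)] {B : (∀ v, X v) → Set (Ω → ℝ)}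
    {S : Finset V} {k : ℕ} (hS : DependsOn B S) (h : ∀ x, Derivable inp A (B x) k) :
    Derivable inp A (⋃ x, B x) ((∏ v ∈ S, Fintype.card (X v)) * k) := by
  have x₀ : ∀ v, X v := fun v => Classical.arbitrary _
  refine ((Derivable.biUnion_const (agreeOff S x₀) fun x _ => h x).mono_right ?_).mono_cost
    (by rw [card_agreeOff])
  refine Set.iUnion_subset fun x => ?_
  rw [hS (x := x) (y := S.piecewise x x₀) fun v hv => by
    simp [Finset.piecewise_eq_of_mem _ _ _ (Finset.mem_coe.1 hv)]]
  refine Set.subset_biUnion_of_mem (u := B) ?_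
  exact mem_agreeOff.2 fun v hv => by simp [hv]

theorem Derivable.iUnion_sumOut [∀ v, Nonempty (X v)] {β : Type*} [AddCommMonoid β]
    {enc : β → Set (Ω → ℝ)} {c : ℕ} (hzero : Derivable inp A (enc 0) c)
    (hadd : ∀ a b, Derivable inp (enc a ∪ enc b) (enc (a + b)) c) {F : (∀ v, X v) → β}
    {S W : Finset V} (hF : DependsOn F S) (hW : W ⊆ S) (hA : ∀ x, enc (F x) ⊆ A) :
    Derivable inp A (⋃ x, enc (sumOut W F x)) (2 * c * ∏ v ∈ S, Fintype.card (X v)) := by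
  have hB : DependsOn (fun x => enc (sumOut W F x)) (S \ W : Finset V) :=
    fun x y h => by simp only [hF.sumOut W h]
  refine (Derivable.iUnion_of_dependsOn hB (k := c * (∏ v ∈ W, Fintype.card (X v)) + c)
    fun x => ?_).mono_cost ?_
  · have := Derivable.multiset_sum hzero hadd F (agreeOff W x).1 fun y _ => hA y
    have hc : (agreeOff W x).1.card = ∏ v ∈ W, Fintype.card (X v) := card_agreeOff W x
    rw [hc] at this
    exact this
  · rw [← Finset.prod_sdiff hW]
    have h1 := card_pos_of_nonempty_pi (X := X) W
    calc _ = c * (∏ v ∈ S \ W, Fintype.card (X v)) * (∏ v ∈ W, Fintype.card (X v) + 1) := by ring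
      _ ≤ c * (∏ v ∈ S \ W, Fintype.card (X v)) * (2 * ∏ v ∈ W, Fintype.card (X v)) :=
        Nat.mul_le_mul_left _ (by omega)
      _ = _ := by ring

end Cost

end SumOut

/-! ### Variable elimination -/

section Elimination

/-- The ring `ℝ[ε, δ]` with `ε² = δ² = 0`: the numbers `a + b ε + c δ + e ε δ`. -/
@[ext]
structure BiDual where
  /-- The constant coefficient. -/
  a : ℝ
  /-- The coefficient of `ε`. -/
  b : ℝ
  /-- The coefficient of `δ`. -/
  c : ℝ
  /-- The coefficient of `ε δ`. -/
  e : ℝ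

namespace BiDual

instance : Zero BiDual := ⟨⟨0, 0, 0, 0⟩⟩
instance : One BiDual := ⟨⟨1, 0, 0, 0⟩⟩
noncomputable instance : Add BiDual := ⟨fun x y => ⟨x.a + y.a, x.b + y.b, x.c + y.c, x.e + y.e⟩⟩
noncomputable instance : Mul BiDual := ⟨fun x y => ⟨x.a * y.a, x.a * y.b + x.b * y.a,
  x.a * y.c + x.c * y.a, x.a * y.e + x.b * y.c + (x.c * y.b + x.e * y.a)⟩⟩

theorem zero_def : (0 : BiDual) = ⟨0, 0, 0, 0⟩ := rfl
theorem one_def : (1 : BiDual) = ⟨1, 0, 0, 0⟩ := rfl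
theorem add_def (x y : BiDual) : x + y = ⟨x.a + y.a, x.b + y.b, x.c + y.c, x.e + y.e⟩ := rfl
theorem mul_def (x y : BiDual) : x * y = ⟨x.a * y.a, x.a * y.b + x.b * y.a,
  x.a * y.c + x.c * y.a, x.a * y.e + x.b * y.c + (x.c * y.b + x.e * y.a)⟩ := rfl

noncomputable instance : CommSemiring BiDual where
  nsmul := nsmulRec
  add_assoc _ _ _ := by ext <;> simp only [add_def] <;> ring
  zero_add _ := by ext <;> simp only [add_def, zero_def] <;> ring
  add_zero _ := by ext <;> simp only [add_def, zero_def] <;> ring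
  add_comm _ _ := by ext <;> simp only [add_def] <;> ring
  left_distrib _ _ _ := by ext <;> simp only [add_def, mul_def] <;> ring
  right_distrib _ _ _ := by ext <;> simp only [add_def, mul_def] <;> ring
  zero_mul _ := by ext <;> simp only [mul_def, zero_def] <;> ring
  mul_zero _ := by ext <;> simp only [mul_def, zero_def] <;> ring
  mul_assoc _ _ _ := by ext <;> simp only [mul_def] <;> ring
  one_mul _ := by ext <;> simp only [mul_def, one_def] <;> ring
  mul_one _ := by ext <;> simp only [mul_def, one_def] <;> ring
  mul_comm _ _ := by ext <;> simp only [mul_def] <;> ring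

/-- The embedding of the real numbers. -/
noncomputable def ofReal : ℝ →+* BiDual where
  toFun r := ⟨r, 0, 0, 0⟩
  map_zero' := rfl
  map_one' := rfl
  map_add' _ _ := by ext <;> simp only [add_def] <;> ring
  map_mul' _ _ := by ext <;> simp only [mul_def] <;> ring

end BiDual

variable {ι Ω : Type*} {inp : Ω → ι → ℝ} {A : Set (Ω → ℝ)}

/-- The four coordinate functions of a function with values in `ℝ[ε, δ]`. -/
def coordFuns (f : Ω → BiDual) : Set (Ω → ℝ) :=
  {fun ω => (f ω).a} ∪ {fun ω => (f ω).b} ∪ ({fun ω => (f ω).c} ∪ {fun ω => (f ω).e})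

namespace Derivable

theorem coordFuns_const (q : ℚ) :
    Derivable inp A (coordFuns fun _ => BiDual.ofReal q) 4 := by
  have h0 : Derivable inp A {fun _ => (0 : ℝ)} 1 := by simpa using const (inp := inp) 0
  exact ((const q).union h0).union (h0.union h0)

theorem coordFuns_zero : Derivable inp A (coordFuns 0) 4 := by
  have h := coordFuns_const (inp := inp) (A := A) 0
  rwa [Rat.cast_zero, map_zero] at h

theorem coordFuns_one : Derivable inp A (coordFuns 1) 4 := by
  have h := coordFuns_const (inp := inp) (A := A) 1
  rwa [Rat.cast_one, map_one] at h

theorem coordFuns_subset {f : Ω → BiDual} (h : coordFuns f ⊆ A) :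
    Derivable inp A {fun ω => (f ω).a} 0 ∧ Derivable inp A {fun ω => (f ω).b} 0 ∧
      Derivable inp A {fun ω => (f ω).c} 0 ∧ Derivable inp A {fun ω => (f ω).e} 0 :=
  ⟨of_mem (h (by simp [coordFuns])), of_mem (h (by simp [coordFuns])),
    of_mem (h (by simp [coordFuns])), of_mem (h (by simp [coordFuns]))⟩

theorem coordFuns_add (f g : Ω → BiDual) :
    Derivable inp (coordFuns f ∪ coordFuns g) (coordFuns (f + g)) 4 := by
  obtain ⟨f0, f1, f2, f3⟩ := coordFuns_subset (inp := inp)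
    (Set.subset_union_left : coordFuns f ⊆ coordFuns f ∪ coordFuns g)
  obtain ⟨g0, g1, g2, g3⟩ := coordFuns_subset (inp := inp)
    (Set.subset_union_right : coordFuns g ⊆ coordFuns f ∪ coordFuns g)
  exact ((f0.add g0).union (f1.add g1)).union ((f2.add g2).union (f3.add g3))

theorem coordFuns_mul (f g : Ω → BiDual) :
    Derivable inp (coordFuns f ∪ coordFuns g) (coordFuns (f * g)) 14 := by
  obtain ⟨f0, f1, f2, f3⟩ := coordFuns_subset (inp := inp)
    (Set.subset_union_left : coordFuns f ⊆ coordFuns f ∪ coordFuns g)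
  obtain ⟨g0, g1, g2, g3⟩ := coordFuns_subset (inp := inp)
    (Set.subset_union_right : coordFuns g ⊆ coordFuns f ∪ coordFuns g)
  exact ((f0.mul g0).union ((f0.mul g1).add (f1.mul g0))).union
    (((f0.mul g2).add (f2.mul g0)).union
      (((f0.mul g3).add (f1.mul g2)).add ((f2.mul g1).add (f3.mul g0))))

end Derivable

theorem Derivable.coordFuns_prod {α : Type*} (F : α → Ω → BiDual) (M : Multiset α)
    (hF : ∀ i ∈ M, coordFuns (F i) ⊆ A) :
    Derivable inp A (coordFuns (M.map F).prod) (14 * M.card + 4) :=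
  Derivable.multiset_prod (β := Ω → BiDual) (enc := coordFuns) Derivable.coordFuns_one
    Derivable.coordFuns_mul F M hF

variable {V : Type*} [Fintype V] [DecidableEq V] {X : V → Type*} [∀ v, Fintype (X v)]
  [∀ v, Nonempty (X v)]

/-- Variable elimination along simplicial vertices of a chordal graph `H`: if the scopes of `m`
factors are cliques of `H` within a set `U` of `n` variables, and `D` bounds the number of
assignments to the variables of a clique, then the sum of the product of the factors over all
assignments takes `O((m + n) D)` steps. To eliminate a simplicial vertex `v` of `U`, the factors
that involve `v` are multiplied and `v` is summed out; the scope of the new factor consists of the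
neighbours of `v` in `U`, which form a clique. Each factor is used only once. -/
theorem Derivable.sum_prod {H : SimpleGraph V} (hH : IsChordal H) {D : ℕ}
    (hD : ∀ S : Finset V, H.IsClique (S : Set V) → ∏ v ∈ S, Fintype.card (X v) ≤ D)
    (U : Finset V) (M : Multiset (Finset V × ((∀ v, X v) → Ω → BiDual)))
    (hM : ∀ φ ∈ M, φ.1 ⊆ U ∧ H.IsClique (φ.1 : Set V) ∧ DependsOn φ.2 φ.1)
    (hA : ∀ φ ∈ M, ∀ x, coordFuns (φ.2 x) ⊆ A) :
    Derivable inp A (coordFuns (∑ x, (M.map fun φ => φ.2 x).prod))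
      (36 * (M.card + 2 * U.card + 1) * D) := by
  have hD1 : 1 ≤ D := by simpa using hD ∅ (by simp)
  have x₀ : ∀ v, X v := fun v => Classical.arbitrary _
  have hscale : ∀ {A : Set (Ω → ℝ)} {f : Ω → BiDual} {k : ℕ} (q : ℚ),
      Derivable inp A (coordFuns f) k →
        Derivable inp A (coordFuns ((fun _ => BiDual.ofReal q) * f)) (k + 18) := fun q h =>
    (((Derivable.coordFuns_const q).union h).trans
      ((Derivable.coordFuns_mul _ _).mono_left Set.subset_union_right)).mono_cost (by omega)
  induction hn : U.card generalizing U M A with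
  | zero =>
    rw [Finset.card_eq_zero] at hn
    subst hn
    have hconst : ∀ x, (M.map fun φ => φ.2 x).prod = (M.map fun φ => φ.2 x₀).prod := fun x => by
      refine congrArg Multiset.prod (Multiset.map_congr rfl fun φ hφ => ?_)
      obtain ⟨h1, -, h2⟩ := hM φ hφ
      exact h2 fun v hv => by simpa using h1 hv
    have h := hscale (Fintype.card (∀ v, X v))
      (Derivable.coordFuns_prod (inp := inp) (fun φ => φ.2 x₀) M fun φ hφ => hA φ hφ x₀)
    have he : (∑ x, (M.map fun φ => φ.2 x).prod) =
        (fun _ => BiDual.ofReal (Fintype.card (∀ v, X v) : ℚ)) *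
          (M.map fun φ => φ.2 x₀).prod := by
      rw [Finset.sum_congr rfl fun x _ => hconst x, Finset.sum_const, Finset.card_univ]
      funext ω
      rw [Pi.smul_apply, Pi.mul_apply, nsmul_eq_mul, Rat.cast_natCast,
        map_natCast]
    rw [he]
    refine h.mono_cost ?_
    calc _ ≤ 36 * (M.card + 1) * 1 := by omega
      _ ≤ _ := Nat.mul_le_mul (by omega) hD1
  | succ n ih =>
    classical
    obtain ⟨v, hv, hcl⟩ := hH.exists_isClique_neighbors U (Finset.card_pos.1 (by omega))
    let T : Finset V := insert v (U.filter fun w => H.Adj v w)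
    have hT : H.IsClique (T : Set V) := by
      have : (T : Set V) = insert v {w | w ∈ U ∧ H.Adj v w} := by ext; simp [T]
      rw [this]
      exact hcl.insert fun b hb _ => hb.2
    have hTU : T ⊆ U := by
      intro w hw
      simp only [T, Finset.mem_insert, Finset.mem_filter] at hw
      rcases hw with rfl | hw
      exacts [hv, hw.1]
    let B := M.filter fun φ => v ∈ φ.1
    let R := M.filter fun φ => v ∉ φ.1
    have hBR : B + R = M := Multiset.filter_add_not _ _
    have hBmem : ∀ φ ∈ B, φ ∈ M ∧ v ∈ φ.1 := fun φ h => Multiset.mem_filter.1 h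
    have hRmem : ∀ φ ∈ R, φ ∈ M ∧ v ∉ φ.1 := fun φ h => Multiset.mem_filter.1 h
    let F : (∀ v, X v) → Ω → BiDual := fun x => (B.map fun φ => φ.2 x).prod
    let G : (∀ v, X v) → Ω → BiDual := fun x => (R.map fun φ => φ.2 x).prod
    have hF : DependsOn F T := by
      intro x y hxy
      refine congrArg Multiset.prod (Multiset.map_congr rfl fun φ hφ => ?_)
      obtain ⟨h1, h2⟩ := hBmem φ hφ
      obtain ⟨h3, h4, h5⟩ := hM φ h1
      refine h5 fun w hw => hxy w ?_
      simp only [T, Finset.mem_coe, Finset.mem_insert, Finset.mem_filter]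
      by_cases hwv : w = v
      · exact Or.inl hwv
      · exact Or.inr ⟨h3 hw, h4 h2 hw (Ne.symm hwv)⟩
    have hG : DependsOn G (({v} : Finset V) : Set V)ᶜ := by
      intro x y hxy
      refine congrArg Multiset.prod (Multiset.map_congr rfl fun φ hφ => ?_)
      obtain ⟨h1, h2⟩ := hRmem φ hφ
      obtain ⟨h3, h4, h5⟩ := hM φ h1
      refine h5 fun w hw => hxy w ?_
      simp only [Finset.coe_singleton, Set.mem_compl_iff, Set.mem_singleton_iff]
      rintro rfl
      exact h2 hw
    have hprod : ∀ x, (M.map fun φ => φ.2 x).prod = F x * G x := fun x => by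
      simp only [F, G]
      rw [← Multiset.prod_add, ← Multiset.map_add, hBR]
    let F' := sumOut {v} F
    have hTv : H.IsClique (T.erase v : Set V) :=
      hT.subset (Finset.coe_subset.2 (Finset.erase_subset v T))
    have hF'dep : DependsOn F' (T.erase v) := by
      rw [← Finset.sdiff_singleton_eq_erase]
      exact hF.sumOut {v}
    -- The sum over all assignments still runs over the values of `v`, on which the product no longer
    -- depends; this multiplies it by the number of these values.
    have hsum : (∑ x, (M.map fun φ => φ.2 x).prod) =
        (fun _ => BiDual.ofReal ((Fintype.card (X v) : ℚ)⁻¹ : ℚ)) *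
          ∑ x, (((T.erase v, F') ::ₘ R).map fun φ => φ.2 x).prod := by
      have h1 : ∀ x, (((T.erase v, F') ::ₘ R).map fun φ => φ.2 x).prod =
          sumOut {v} (fun y => F y * G y) x := fun x => by
        rw [sumOut_mul_right hG, Multiset.map_cons, Multiset.prod_cons]
      have h2 : (Fintype.card (X v) : ℝ) ≠ 0 := by
        exact_mod_cast (Fintype.card_pos (α := X v)).ne'
      rw [Finset.sum_congr rfl fun x _ => hprod x, Finset.sum_congr rfl fun x _ => h1 x,
        sum_sumOut, Finset.prod_singleton]
      funext ω
      rw [Pi.mul_apply, Pi.smul_apply, nsmul_eq_mul, ← mul_assoc,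
        ← map_natCast (BiDual.ofReal), ← map_mul]
      rw [Rat.cast_inv, Rat.cast_natCast, inv_mul_cancel₀ h2, map_one, one_mul]
    rw [hsum]
    have hFd : Derivable inp A (⋃ x, coordFuns (F x))
        ((∏ w ∈ T, Fintype.card (X w)) * (14 * B.card + 4)) := by
      have hdep : DependsOn (fun x => coordFuns (F x)) (T : Set V) := fun x y h => by
        simp only [hF h]
      have hstep : ∀ x, Derivable inp A (coordFuns (F x)) (14 * B.card + 4) := fun x => by
        have hx : ∀ φ ∈ B, coordFuns (φ.2 x) ⊆ A := fun φ hφ => hA φ (hBmem φ hφ).1 x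
        exact Derivable.coordFuns_prod _ B hx
      exact Derivable.iUnion_of_dependsOn hdep hstep
    have hF'd : Derivable inp (A ∪ ⋃ x, coordFuns (F x)) (⋃ x, coordFuns (F' x))
        (2 * 4 * ∏ w ∈ T, Fintype.card (X w)) :=
      Derivable.iUnion_sumOut Derivable.coordFuns_zero Derivable.coordFuns_add hF
        (by simp [T]) fun x =>
          Set.subset_union_of_subset_right (Set.subset_iUnion (fun x => coordFuns (F x)) x) _
    have hrec := ih (A := A ∪ ⋃ x, coordFuns (F' x)) (U.erase v) ((T.erase v, F') ::ₘ R) ?_ ?_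
      (by rw [Finset.card_erase_of_mem hv]; omega)
    · have hfin := hscale ((Fintype.card (X v) : ℚ)⁻¹) ((hFd.trans hF'd).trans hrec)
      refine Derivable.mono_cost hfin ?_
      have hTD := hD T hT
      have hc : M.card = B.card + R.card := by rw [← hBR, Multiset.card_add]
      rw [Multiset.card_cons, hc]
      calc _ ≤ D * (14 * B.card + 4) + 2 * 4 * D + 36 * (R.card + 1 + 2 * n + 1) * D + 18 * D := by
            gcongr
            omega
        _ = (14 * B.card + 36 * R.card + 72 * n + 102) * D := by ring
        _ ≤ (36 * (B.card + R.card + 2 * (n + 1) + 1)) * D := Nat.mul_le_mul_right _ (by omega)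
    · intro φ hφ
      rcases Multiset.mem_cons.1 hφ with rfl | hφ
      · exact ⟨Finset.erase_subset_erase v hTU, hTv, hF'dep⟩
      · obtain ⟨h1, h2⟩ := hRmem φ hφ
        obtain ⟨h3, h4⟩ := hM φ h1
        exact ⟨fun w hw => Finset.mem_erase.2 ⟨fun h => h2 (h ▸ hw), h3 hw⟩, h4⟩
    · intro φ hφ x
      rcases Multiset.mem_cons.1 hφ with rfl | hφ
      · exact Set.subset_union_of_subset_right (Set.subset_iUnion (fun x => coordFuns (F' x)) x) _
      · exact Set.subset_union_of_subset_left (hA φ (hRmem φ hφ).1 x) _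

end Elimination

/-! ### Marginals of decomposable models along a partition -/

section Marginals

variable {V : Type*} {X : V → Type*}

theorem isClique_of_setsToCliques_le {𝒩 : Finset (Finset V)} {H : SimpleGraph V}
    (hH : setsToCliques 𝒩 ≤ H) {N : Finset V} (hN : N ∈ 𝒩) : H.IsClique (N : Set V) :=
  fun _ ha _ hb hab => hH ⟨hab, N, hN, ha, hb⟩

theorem subset_of_mem_maxCliquesIn {G : SimpleGraph V} {N C : Finset V}
    (h : C ∈ maxCliquesIn G N) : C ⊆ N := by
  classical
  rw [maxCliquesIn, Finset.mem_filter, Finset.mem_powerset] at h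
  exact h.1

theorem maxCliquesIn_nonempty (G : SimpleGraph V) (N : Finset V) :
    (maxCliquesIn G N).Nonempty := by
  classical
  obtain ⟨C, -, hC⟩ := Finset.exists_le_maximal
    (N.powerset.filter fun s : Finset V => G.IsClique (s : Set V)) (a := ∅) (by simp)
  simp only [Finset.mem_filter, Finset.mem_powerset] at hC
  exact ⟨C, by
    rw [maxCliquesIn, Finset.mem_filter, Finset.mem_powerset]
    exact ⟨hC.1.1, hC⟩⟩

variable [Fintype V] [DecidableEq V]

namespace IsNPartition

variable {G : SimpleGraph V} {Z : Finset V} {𝒩 : Finset (Finset V)}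

theorem sum_card_maxCliquesIn (h : IsNPartition G Z 𝒩) :
    ∑ N ∈ 𝒩, (maxCliquesIn G N).card = (maxCliques G).card := by
  rw [← h.cliques_cover, Finset.card_biUnion h.cliques_disjoint]

theorem card_le (h : IsNPartition G Z 𝒩) : 𝒩.card ≤ (maxCliques G).card := by
  rw [← h.sum_card_maxCliquesIn, Finset.card_eq_sum_ones]
  exact Finset.sum_le_sum fun N _ => (maxCliquesIn_nonempty G N).card_pos

theorem subset_maxCliques (h : IsNPartition G Z 𝒩) {N : Finset V} (hN : N ∈ 𝒩) :
    maxCliquesIn G N ⊆ maxCliques G := by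
  rw [← h.cliques_cover]
  exact Finset.subset_biUnion_of_mem (fun N => maxCliquesIn G N) hN

theorem exists_subset (h : IsNPartition G Z 𝒩) {C : Finset V} (hC : C ∈ maxCliques G) :
    ∃ N ∈ 𝒩, C ⊆ N := by
  rw [← h.cliques_cover, Finset.mem_biUnion] at hC
  obtain ⟨N, hN, hCN⟩ := hC
  exact ⟨N, hN, subset_of_mem_maxCliquesIn hCN⟩

theorem pairwiseDisjoint_inter_compl (h : IsNPartition G Z 𝒩) {U : Finset V} (hU : Z ⊆ U) :
    (𝒩 : Set (Finset V)).PairwiseDisjoint fun N => N ∩ Uᶜ := by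
  refine h.vars_disjoint.mono fun N v hv => ?_
  simp only [Finset.mem_inter, Finset.mem_compl, Finset.mem_sdiff] at hv ⊢
  exact ⟨hv.1, fun h => hv.2 (hU h)⟩

theorem biUnion_inter_compl (h : IsNPartition G Z 𝒩) {U : Finset V} (hU : Z ⊆ U) :
    (𝒩.biUnion fun N => N ∩ Uᶜ) = Uᶜ := by
  ext v
  have := Finset.ext_iff.1 h.vars_cover v
  simp only [Finset.mem_biUnion, Finset.mem_sdiff, Finset.mem_univ, true_and, Finset.mem_inter,
    Finset.mem_compl] at this ⊢
  constructor
  · rintro ⟨N, -, -, hv⟩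
    exact hv
  · intro hv
    obtain ⟨N, hN, hvN, -⟩ := this.2 fun h => hv (hU h)
    exact ⟨N, hN, hvN, hv⟩

end IsNPartition

variable {Ω : Type*} {G : SimpleGraph V}

open Classical in
/-- The table of the maximal clique `C` in a family `t` of tables, as a function of all variables;
one if `C` is no maximal clique. -/
noncomputable def cliqueFactor (t : Ω → TableEntry G X → ℝ) (C : Finset V) (x : ∀ v, X v) (ω : Ω) :
    ℝ :=
  if h : C ∈ maxCliques G then t ω ⟨⟨C, h⟩, C.restrict x⟩ else 1

/-- The product of the tables of the maximal cliques of `G(N)`. -/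
noncomputable def partFactor (t : Ω → TableEntry G X → ℝ) (N : Finset V) (x : ∀ v, X v) :
    Ω → ℝ :=
  ∏ C ∈ maxCliquesIn G N, cliqueFactor t C x

theorem dependsOn_partFactor (t : Ω → TableEntry G X → ℝ) (N : Finset V) :
    DependsOn (partFactor t N) (N : Set V) := by
  refine DependsOn.finset_prod (F := fun C => cliqueFactor t C) fun C hC => fun x y hxy => ?_
  have hC' := subset_of_mem_maxCliquesIn hC
  have : C.restrict x = C.restrict y := funext fun v => hxy v (hC' v.2)
  funext ω
  simp only [cliqueFactor, this]

variable [∀ v, Fintype (X v)]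

/-- The factor of the part `N` in the marginal over the variables in `U`: the product of the
tables of the maximal cliques of `G(N)`, with the variables outside `U` summed out. -/
noncomputable def partMarginal (t : Ω → TableEntry G X → ℝ) (U N : Finset V) (x : ∀ v, X v) :
    Ω → ℝ :=
  sumOut (N ∩ Uᶜ) (partFactor t N) x

theorem dependsOn_partMarginal (t : Ω → TableEntry G X → ℝ) (U N : Finset V) :
    DependsOn (partMarginal t U N) (N : Set V) :=
  ((dependsOn_partFactor t N).sumOut _).mono (Finset.coe_subset.2 Finset.sdiff_subset)

/-- If `p` is the product of its tables, then its marginal over a set `U` that contains `Z`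
factorizes over the parts of an `𝒩`-partition for `Z`. -/
theorem sumOut_compl_eq_prod_partMarginal {t : Ω → TableEntry G X → ℝ} {Z U : Finset V}
    {𝒩 : Finset (Finset V)} (h : IsNPartition G Z 𝒩) (hU : Z ⊆ U) {p : Ω → (∀ v, X v) → ℝ}
    (hp : ∀ ω x, p ω x = ∏ C : MaxClique G, t ω ⟨C, C.1.restrict x⟩) (ω : Ω) (x : ∀ v, X v) :
    sumOut Uᶜ (p ω) x = ∏ N ∈ 𝒩, partMarginal t U N x ω := by
  have hp' : ∀ x, (fun ω => p ω x) = ∏ N ∈ 𝒩, partFactor t N x := by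
    intro x
    simp only [partFactor]
    rw [← Finset.prod_biUnion h.cliques_disjoint, h.cliques_cover]
    funext ω
    rw [hp, Finset.prod_apply, ← Finset.prod_coe_sort (maxCliques G) fun C => cliqueFactor t C x ω]
    refine Finset.prod_congr rfl fun C _ => ?_
    rw [cliqueFactor, dif_pos C.2]
  have hs : sumOut Uᶜ (fun x ω => p ω x) x = ∏ N ∈ 𝒩, partMarginal t U N x := by
    have hp'' : (fun x ω => p ω x) = fun x => ∏ N ∈ 𝒩, partFactor t N x := funext hp'
    simp only [hp'', partMarginal]
    rw [← sumOut_prod Uᶜ 𝒩 (partFactor t) (fun N _ => dependsOn_partFactor t N)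
      (h.pairwiseDisjoint_inter_compl hU), h.biUnion_inter_compl hU]
  have := congrFun hs ω
  rwa [sumOut, Finset.sum_apply, Finset.prod_apply] at this

variable [∀ v, DecidableEq (X v)]

theorem filter_restrict_eq (U : Finset V) (x : ∀ v, X v) :
    (Finset.univ.filter fun y : ∀ v, X v => U.restrict y = U.restrict x) = agreeOff Uᶜ x := by
  ext y
  simp only [Finset.mem_filter, Finset.mem_univ, true_and, mem_agreeOff, Finset.mem_compl,
    not_not, funext_iff, Finset.restrict, Subtype.forall]

theorem filter_restrict_and_eq (Y Z : Finset V) (x : ∀ v, X v) :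
    (Finset.univ.filter fun y : ∀ v, X v =>
      Y.restrict y = Y.restrict x ∧ Z.restrict y = Z.restrict x) = agreeOff (Y ∪ Z)ᶜ x := by
  ext y
  simp only [Finset.mem_filter, Finset.mem_univ, true_and, mem_agreeOff, Finset.mem_compl,
    not_not, funext_iff, Finset.restrict, Subtype.forall, Finset.mem_union]
  exact ⟨fun h v hv => hv.elim (h.1 v) (h.2 v), fun h => ⟨fun v hv => h v (Or.inl hv),
    fun v hv => h v (Or.inr hv)⟩⟩

theorem marginal_restrict (p : (∀ v, X v) → ℝ) (U : Finset V) (x : ∀ v, X v) :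
    marginal p U (U.restrict x) = sumOut Uᶜ p x := by
  rw [marginal, filter_restrict_eq, sumOut]

theorem conditional_restrict (p : (∀ v, X v) → ℝ) (Y Z : Finset V) (x : ∀ v, X v) :
    conditional p Y Z (Z.restrict x) (Y.restrict x) = sumOut (Y ∪ Z)ᶜ p x / sumOut Zᶜ p x := by
  rw [conditional, marginal_restrict, filter_restrict_and_eq]
  rfl

/-- A sum over the values of the variables in `Y` and `Z`, as a sum over all assignments: each
pair of values is counted once for each assignment to the other variables. -/
theorem sum_restrict_restrict [∀ v, Nonempty (X v)] {Y Z : Finset V} (hd : Disjoint Z Y)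
    (F : (∀ v : Z, X v) → (∀ v : Y, X v) → ℝ) :
    ∑ x : ∀ v, X v, F (Z.restrict x) (Y.restrict x) =
      (∏ v ∈ (Y ∪ Z)ᶜ, Fintype.card (X v) : ℕ) * ∑ z, ∑ y, F z y := by
  have hfib : ∀ z : (∀ v : Z, X v), ∀ y : (∀ v : Y, X v),
      (Finset.univ.filter fun x : ∀ v, X v => Y.restrict x = y ∧ Z.restrict x = z).card =
        ∏ v ∈ (Y ∪ Z)ᶜ, Fintype.card (X v) := by
    intro z y
    let x : ∀ v, X v := fun v => if h : v ∈ Z then z ⟨v, h⟩ else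
      if h : v ∈ Y then y ⟨v, h⟩ else Classical.arbitrary _
    have hz : Z.restrict x = z := by
      ext ⟨v, hv⟩
      simp [x, hv]
    have hy : Y.restrict x = y := by
      ext ⟨v, hv⟩
      have hvZ : v ∉ Z := fun h => Finset.disjoint_left.1 hd h hv
      simp [x, hv, hvZ]
    rw [← hz, ← hy, filter_restrict_and_eq, card_agreeOff]
  rw [Finset.mul_sum, ← Finset.sum_fiberwise Finset.univ (fun x : ∀ v, X v => Z.restrict x)]
  refine Finset.sum_congr rfl fun z _ => ?_
  rw [Finset.mul_sum, ← Finset.sum_fiberwise _ (fun x : ∀ v, X v => Y.restrict x)]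
  refine Finset.sum_congr rfl fun y _ => ?_
  rw [Finset.filter_filter, ← hfib z y, ← nsmul_eq_mul, ← Finset.sum_const]
  refine Finset.sum_congr (by simp only [and_comm]) fun x hx => ?_
  rw [Finset.mem_filter] at hx
  rw [hx.2.1, hx.2.2]

theorem condABDiv_zero_eq [∀ v, Nonempty (X v)] {Y Z : Finset V} (hd : Disjoint Z Y)
    (p q : (∀ v, X v) → ℝ) :
    condABDiv 0 0 p q Y Z = ((2 * ∏ v ∈ (Y ∪ Z)ᶜ, Fintype.card (X v) : ℕ) : ℝ)⁻¹ *
      ∑ x, sumOut Zᶜ p x * (Real.log (sumOut (Y ∪ Z)ᶜ p x / sumOut Zᶜ p x) -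
        Real.log (sumOut (Y ∪ Z)ᶜ q x / sumOut Zᶜ q x)) ^ 2 := by
  have h := sum_restrict_restrict (X := X) hd fun z y => marginal p Z z *
    (Real.log (conditional p Y Z z y) - Real.log (conditional q Y Z z y)) ^ 2
  simp only [marginal_restrict, conditional_restrict] at h
  have hc : ((∏ v ∈ (Y ∪ Z)ᶜ, Fintype.card (X v) : ℕ) : ℝ) ≠ 0 := by
    exact_mod_cast (card_pos_of_nonempty_pi (X := X) (Y ∪ Z)ᶜ).ne'
  rw [h, Nat.cast_mul, mul_inv, mul_assoc, inv_mul_cancel_left₀ hc, condABDiv, Finset.mul_sum]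
  refine Finset.sum_congr rfl fun z _ => ?_
  rw [abDiv, Finset.mul_sum, Finset.mul_sum]
  refine Finset.sum_congr rfl fun y _ => ?_
  rw [abDivPoint, if_pos ⟨rfl, rfl⟩]
  push_cast
  ring

end Marginals

/-! ### Programs for the conditional divergence -/

section Program

/-- The element `w (1 + g ε) (1 + g δ)`. Under multiplication the weights `w` multiply and the
exponents `g` add up. -/
noncomputable def BiDual.twist (w g : ℝ) : BiDual := ⟨w, w * g, w * g, w * (g * g)⟩

theorem BiDual.twist_mul_twist (w g w' g' : ℝ) :
    twist w g * twist w' g' = twist (w * w') (g + g') := by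
  ext <;> simp only [twist, mul_def] <;> ring

theorem BiDual.prod_twist {α : Type*} (s : Finset α) (w g : α → ℝ) :
    ∏ i ∈ s, twist (w i) (g i) = twist (∏ i ∈ s, w i) (∑ i ∈ s, g i) := by
  classical
  induction s using Finset.induction_on with
  | empty => simp [twist, one_def]
  | insert a s ha ih =>
    rw [Finset.prod_insert ha, Finset.prod_insert ha, Finset.sum_insert ha, ih, twist_mul_twist]

theorem BiDual.e_sum {α : Type*} (s : Finset α) (f : α → BiDual) :
    (∑ i ∈ s, f i).e = ∑ i ∈ s, (f i).e :=
  map_sum (⟨⟨BiDual.e, rfl⟩, fun _ _ => rfl⟩ : BiDual →+ ℝ) f s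

variable {V : Type*} [Fintype V] [DecidableEq V] {X : V → Type*} [∀ v, Fintype (X v)]
  {ι Ω : Type*} {inp : Ω → ι → ℝ} {A : Set (Ω → ℝ)} {G : SimpleGraph V}

/-- The contribution of the part `N` to the logarithm of a quotient of marginals over `U₁` and
`U₂`. -/
noncomputable def partLogRatio (t : Ω → TableEntry G X → ℝ) (U₁ U₂ N : Finset V) (x : ∀ v, X v)
    (ω : Ω) : ℝ :=
  Real.log (partMarginal t U₁ N x ω) - Real.log (partMarginal t U₂ N x ω)

theorem dependsOn_partLogRatio (t : Ω → TableEntry G X → ℝ) (U₁ U₂ N : Finset V) :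
    DependsOn (partLogRatio t U₁ U₂ N) (N : Set V) := fun x y h => by
  funext ω
  rw [partLogRatio, partLogRatio, dependsOn_partMarginal t U₁ N h, dependsOn_partMarginal t U₂ N h]

/-- The logarithm of a quotient of marginals is a sum over the parts. -/
theorem log_div_eq_sum_partLogRatio {t : Ω → TableEntry G X → ℝ} {Z U₁ U₂ : Finset V}
    {𝒩 : Finset (Finset V)} (h : IsNPartition G Z 𝒩) (h₁ : Z ⊆ U₁) (h₂ : Z ⊆ U₂)
    {p : Ω → (∀ v, X v) → ℝ} (hp : ∀ ω x, p ω x = ∏ C : MaxClique G, t ω ⟨C, C.1.restrict x⟩)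
    (hpos : ∀ ω x, 0 < p ω x) (ω : Ω) (x : ∀ v, X v) :
    Real.log (sumOut U₁ᶜ (p ω) x / sumOut U₂ᶜ (p ω) x) =
      ∑ N ∈ 𝒩, partLogRatio t U₁ U₂ N x ω := by
  have hne : ∀ U : Finset V, sumOut Uᶜ (p ω) x ≠ 0 := fun U =>
    (Finset.sum_pos (fun y _ => hpos ω y) ⟨x, mem_agreeOff.2 fun _ _ => rfl⟩).ne'
  have n₁ := hne U₁
  have n₂ := hne U₂
  rw [Real.log_div n₁ n₂]
  rw [sumOut_compl_eq_prod_partMarginal h h₁ hp] at n₁ ⊢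
  rw [sumOut_compl_eq_prod_partMarginal h h₂ hp] at n₂ ⊢
  rw [Finset.prod_ne_zero_iff] at n₁ n₂
  rw [Real.log_prod n₁, Real.log_prod n₂, ← Finset.sum_sub_distrib]
  rfl

variable [∀ v, Nonempty (X v)]

theorem Derivable.iUnion_partFactor (t : Ω → TableEntry G X → ℝ) {N : Finset V}
    (hN : maxCliquesIn G N ⊆ maxCliques G) (hA : ∀ e, (fun ω => t ω e) ∈ A) :
    Derivable inp A (⋃ x, {partFactor t N x})
      ((∏ v ∈ N, Fintype.card (X v)) * ((maxCliquesIn G N).card + 1)) := by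
  have hdep : DependsOn (fun x => ({partFactor t N x} : Set (Ω → ℝ))) (N : Set V) :=
    fun x y h => by simp only [dependsOn_partFactor t N h]
  refine Derivable.iUnion_of_dependsOn hdep fun x => ?_
  have hone : Derivable inp A ({1} : Set (Ω → ℝ)) 1 := by
    have := Derivable.const (inp := inp) (A := A) 1
    rw [Rat.cast_one] at this
    exact this
  have hmul : ∀ f g : Ω → ℝ, Derivable inp ({f} ∪ {g}) {f * g} 1 := fun f g =>
    Derivable.mul (k := 0) (l := 0) (.of_mem (by simp)) (.of_mem (by simp))
  have hF : ∀ C ∈ (maxCliquesIn G N).1, ({cliqueFactor t C x} : Set (Ω → ℝ)) ⊆ A := by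
    intro C hC
    have hC' : C ∈ maxCliques G := hN hC
    have : cliqueFactor t C x = fun ω => t ω ⟨⟨C, hC'⟩, C.restrict x⟩ := by
      funext ω
      rw [cliqueFactor, dif_pos hC']
    rw [this, Set.singleton_subset_iff]
    exact hA _
  have h := Derivable.multiset_prod (enc := fun f : Ω → ℝ => {f}) hone hmul
    (fun C => cliqueFactor t C x) (maxCliquesIn G N).1 hF
  rw [one_mul] at h
  exact h

/-- Multiplying the tables takes `D` steps for each maximal clique of `G(N)`; the sums and the
logarithms take `O(D)` more. -/
theorem Derivable.iUnion_partLogRatio (t : Ω → TableEntry G X → ℝ) {N : Finset V}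
    (hN : maxCliquesIn G N ⊆ maxCliques G) (hA : ∀ e, (fun ω => t ω e) ∈ A) {D : ℕ}
    (hD : ∏ v ∈ N, Fintype.card (X v) ≤ D) (U₁ U₂ : Finset V) :
    Derivable inp A ((⋃ x, {partMarginal t U₁ N x}) ∪ (⋃ x, {partMarginal t U₂ N x}) ∪
      ⋃ x, {partLogRatio t U₁ U₂ N x}) (D * ((maxCliquesIn G N).card + 8)) := by
  set B : Set (Ω → ℝ) := ⋃ x, {partFactor t N x} with hB
  have hzero : ∀ {A : Set (Ω → ℝ)}, Derivable inp A ({0} : Set (Ω → ℝ)) 1 := fun {A} => by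
    have := Derivable.const (inp := inp) (A := A) 0
    rw [Rat.cast_zero] at this
    exact this
  have hadd : ∀ f g : Ω → ℝ, Derivable inp ({f} ∪ {g}) {f + g} 1 := fun f g =>
    Derivable.add (k := 0) (l := 0) (.of_mem (by simp)) (.of_mem (by simp))
  have hmarg : ∀ U, Derivable inp (A ∪ B) (⋃ x, {partMarginal t U N x})
      (2 * 1 * ∏ v ∈ N, Fintype.card (X v)) := fun U =>
    Derivable.iUnion_sumOut (enc := fun f : Ω → ℝ => {f}) hzero hadd (dependsOn_partFactor t N)
      Finset.inter_subset_left fun x => Set.subset_union_of_subset_right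
        (Set.subset_iUnion (fun x => ({partFactor t N x} : Set (Ω → ℝ))) x) _
  have hBoth := (Derivable.iUnion_partFactor (inp := inp) t hN hA).trans
    ((hmarg U₁).union (hmarg U₂))
  set B' : Set (Ω → ℝ) := (⋃ x, {partMarginal t U₁ N x}) ∪ ⋃ x, {partMarginal t U₂ N x} with hB'
  have hdep : DependsOn (fun x => ({partLogRatio t U₁ U₂ N x} : Set (Ω → ℝ))) (N : Set V) :=
    fun x y h => by simp only [dependsOn_partLogRatio t U₁ U₂ N h]
  have hlog : Derivable inp (A ∪ B') (⋃ x, {partLogRatio t U₁ U₂ N x})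
      ((∏ v ∈ N, Fintype.card (X v)) * 3) := by
    refine Derivable.iUnion_of_dependsOn hdep fun x => ?_
    have h₁ : Derivable inp (A ∪ B') {partMarginal t U₁ N x} 0 :=
      .of_mem (Or.inr (Or.inl (Set.mem_iUnion.2 ⟨x, rfl⟩)))
    have h₂ : Derivable inp (A ∪ B') {partMarginal t U₂ N x} 0 :=
      .of_mem (Or.inr (Or.inr (Set.mem_iUnion.2 ⟨x, rfl⟩)))
    exact h₁.log.sub h₂.log
  have hall := hBoth.trans ((Derivable.of_subset (inp := inp)
    (Set.subset_union_right : B' ⊆ A ∪ B')).union hlog)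
  refine hall.mono_cost ?_
  calc _ = (∏ v ∈ N, Fintype.card (X v)) * ((maxCliquesIn G N).card + 8) := by ring
    _ ≤ _ := Nat.mul_le_mul_right _ hD

/-- The factors `w (1 + g ε) (1 + g δ)` of the part `N`, from the tables of the weights `w` and
the exponents `g`. -/
theorem Derivable.iUnion_twist {w g : (∀ v, X v) → Ω → ℝ} {N : Finset V} {D : ℕ}
    (hD : ∏ v ∈ N, Fintype.card (X v) ≤ D) (hw : DependsOn w N) (hg : DependsOn g N)
    (hwA : ∀ x, Derivable inp A {w x} 1) (hgA : ∀ x, g x ∈ A) :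
    Derivable inp A (⋃ x, coordFuns fun ω => BiDual.twist (w x ω) (g x ω)) (D * 8) := by
  have hdep : DependsOn (fun x => coordFuns fun ω => BiDual.twist (w x ω) (g x ω)) (N : Set V) :=
    fun x y h => by simp only [hw h, hg h]
  refine (Derivable.iUnion_of_dependsOn (k := 8) hdep fun x => ?_).mono_cost
    (Nat.mul_le_mul_right _ hD)
  have h₁ := hwA x
  have h₂ : Derivable inp A {g x} 0 := .of_mem (hgA x)
  exact ((h₁.union (h₁.mul h₂)).union ((h₁.mul h₂).union (h₁.mul (h₂.mul h₂)))).mono_cost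
    (by norm_num)

end Program

/-! ### The bound on the number of steps -/

section Bound

variable {V : Type*} [Fintype V] [DecidableEq V] {X : V → Type*} [∀ v, Fintype (X v)]
  {ι Ω : Type*} {inp : Ω → ι → ℝ} {A : Set (Ω → ℝ)} {G : SimpleGraph V}

theorem card_tableEntry_le {D : ℕ}
    (hD : ∀ C ∈ maxCliques G, ∏ v ∈ C, Fintype.card (X v) ≤ D) :
    Fintype.card (TableEntry G X) ≤ (maxCliques G).card * D := by
  rw [Fintype.card_sigma]
  refine (Finset.sum_le_card_nsmul _ _ D fun C _ => ?_).trans (by simp)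
  rw [Fintype.card_pi]
  exact (Finset.prod_coe_sort C.1 fun v => Fintype.card (X v)).trans_le (hD C.1 C.2)

/-- The factors of all parts of an `𝒩`-partition, weighted either by the marginals over `U₂` or by
one, are computed in `O(|V| D)` steps. -/
theorem Derivable.biUnion_twist [∀ v, Nonempty (X v)] (hG : IsChordal G) {Z : Finset V}
    {𝒩 : Finset (Finset V)} (h : IsNPartition G Z 𝒩) {D : ℕ}
    (hD : ∀ N ∈ 𝒩, ∏ v ∈ N, Fintype.card (X v) ≤ D) (t : Ω → TableEntry G X → ℝ)
    (hA : ∀ e, (fun ω => t ω e) ∈ A) (U₁ U₂ : Finset V)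
    (w : Finset V → (∀ v, X v) → Ω → ℝ)
    (hw : w = partMarginal t U₂ ∨ w = 1) :
    Derivable inp A
      (⋃ N ∈ 𝒩, ⋃ x, coordFuns fun ω => BiDual.twist (w N x ω) (partLogRatio t U₁ U₂ N x ω))
      (17 * (Fintype.card V + 1) * D) := by
  have hc : (maxCliques G).card ≤ Fintype.card V + 1 := hG.card_maxCliquesIn_le Finset.univ
  have hpart : ∀ N ∈ 𝒩, Derivable inp A
      (⋃ x, coordFuns fun ω => BiDual.twist (w N x ω) (partLogRatio t U₁ U₂ N x ω))
      (D * ((maxCliquesIn G N).card + 16)) := by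
    intro N hN
    refine ((Derivable.iUnion_partLogRatio t (h.subset_maxCliques hN) hA (hD N hN) U₁ U₂).trans
      (Derivable.iUnion_twist (hD N hN) ?_ (dependsOn_partLogRatio t U₁ U₂ N) (fun x => ?_)
        fun x => Or.inr (Or.inr (Set.mem_iUnion.2 ⟨x, rfl⟩)))).mono_cost (by ring_nf; rfl)
    · rcases hw with rfl | rfl
      · exact dependsOn_partMarginal t U₂ N
      · exact fun _ _ _ => rfl
    · rcases hw with rfl | rfl
      · have hm : partMarginal t U₂ N x ∈ ⋃ x, ({partMarginal t U₂ N x} : Set (Ω → ℝ)) :=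
          Set.mem_iUnion.2 ⟨x, rfl⟩
        exact (Derivable.of_mem (Or.inr (Or.inl (Or.inr hm)))).mono_cost zero_le_one
      · have := Derivable.const (inp := inp)
          (A := A ∪ ((⋃ x, {partMarginal t U₁ N x}) ∪ (⋃ x, {partMarginal t U₂ N x}) ∪
            ⋃ x, {partLogRatio t U₁ U₂ N x})) 1
        rw [Rat.cast_one] at this
        exact this
  refine (Derivable.biUnion 𝒩 hpart).mono_cost ?_
  rw [← Finset.mul_sum, Finset.sum_add_distrib, h.sum_card_maxCliquesIn, Finset.sum_const,
    smul_eq_mul, mul_comm]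
  have h1 := h.card_le
  exact Nat.mul_le_mul_right _ (by omega)

variable [∀ v, DecidableEq (X v)]

/-- The bound for chordal graphs and variables that have values, as both hold whenever models
exist; `D` bounds the number of assignments to a clique of the computation graph. -/
theorem exists_program_condABDiv [Nonempty V] [∀ v, Nonempty (X v)] {GP GQ H : SimpleGraph V}
    (hGP : IsChordal GP) (hGQ : IsChordal GQ) {Y Z : Finset V} (hd : Disjoint Z Y)
    {NP NQ : Finset (Finset V)} (hNP : IsNPartition GP Z NP) (hNQ : IsNPartition GQ Z NQ)
    (hH : IsComputationGraph (setsToCliques NP) (setsToCliques NQ) H) {D : ℕ}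
    (hD : ∀ S : Finset V, H.IsClique (S : Set V) → ∏ v ∈ S, Fintype.card (X v) ≤ D) :
    ∃ prog : SLP (TableEntry GP X ⊕ TableEntry GQ X),
      prog.steps ≤ 327 * (Fintype.card V ^ 2 * D) ∧
      ∀ (P : DecomposableModel GP X) (Q : DecomposableModel GQ X),
        prog.output (Sum.elim P.table Q.table) = condABDiv 0 0 P.prob Q.prob Y Z := by
  obtain ⟨hHc, hHP, hHQ⟩ := hH
  have hD1 : 1 ≤ D := by simpa using hD ∅ (by simp)
  have hDP : ∀ N ∈ NP, ∏ v ∈ N, Fintype.card (X v) ≤ D := fun N hN =>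
    hD N (isClique_of_setsToCliques_le hHP hN)
  have hDQ : ∀ N ∈ NQ, ∏ v ∈ N, Fintype.card (X v) ≤ D := fun N hN =>
    hD N (isClique_of_setsToCliques_le hHQ hN)
  have hcP : (maxCliques GP).card ≤ Fintype.card V + 1 := hGP.card_maxCliquesIn_le Finset.univ
  have hcQ : (maxCliques GQ).card ≤ Fintype.card V + 1 := hGQ.card_maxCliquesIn_le Finset.univ
  let Ω := DecomposableModel GP X × DecomposableModel GQ X
  let inp : Ω → TableEntry GP X ⊕ TableEntry GQ X → ℝ := fun ω => Sum.elim ω.1.table ω.2.table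
  let tP : Ω → TableEntry GP X → ℝ := fun ω => ω.1.table
  let tQ : Ω → TableEntry GQ X → ℝ := fun ω => ω.2.table
  let wP : Finset V → (∀ v, X v) → Ω → ℝ := partMarginal tP Z
  let gP : Finset V → (∀ v, X v) → Ω → ℝ := partLogRatio tP (Y ∪ Z) Z
  -- The order of `Y ∪ Z` and `Z` is reversed for the second model, whose logarithm is subtracted.
  let gQ : Finset V → (∀ v, X v) → Ω → ℝ := partLogRatio tQ Z (Y ∪ Z)
  let φP : Finset V → (∀ v, X v) → Ω → BiDual := fun N x ω => .twist (wP N x ω) (gP N x ω)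
  let φQ : Finset V → (∀ v, X v) → Ω → BiDual := fun N x ω => .twist 1 (gQ N x ω)
  let I : Set (Ω → ℝ) := ⋃ i ∈ Finset.univ, {fun ω => inp ω i}
  have hI : Derivable inp ∅ I (2 * (Fintype.card V + 1) * D) := by
    refine (Derivable.biUnion_const Finset.univ fun i _ => Derivable.input i).mono_cost ?_
    rw [Finset.card_univ, Fintype.card_sum, mul_one]
    have h1 : Fintype.card (TableEntry GP X) ≤ _ := card_tableEntry_le fun C hC => by
      obtain ⟨N, hN, hCN⟩ := hNP.exists_subset hC
      exact hD C ((isClique_of_setsToCliques_le hHP hN).subset (Finset.coe_subset.2 hCN))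
    have h2 : Fintype.card (TableEntry GQ X) ≤ _ := card_tableEntry_le fun C hC => by
      obtain ⟨N, hN, hCN⟩ := hNQ.exists_subset hC
      exact hD C ((isClique_of_setsToCliques_le hHQ hN).subset (Finset.coe_subset.2 hCN))
    have h3 := Nat.mul_le_mul_right D hcP
    have h4 := Nat.mul_le_mul_right D hcQ
    linarith
  have hIP : ∀ e, (fun ω => tP ω e) ∈ ∅ ∪ I := fun e =>
    Or.inr (Set.mem_biUnion (Finset.mem_coe.2 (Finset.mem_univ (Sum.inl e))) rfl)
  have hIQ : ∀ e, (fun ω => tQ ω e) ∈ ∅ ∪ I := fun e =>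
    Or.inr (Set.mem_biUnion (Finset.mem_coe.2 (Finset.mem_univ (Sum.inr e))) rfl)
  have hφP : Derivable inp (∅ ∪ I) (⋃ N ∈ NP, ⋃ x, coordFuns (φP N x))
      (17 * (Fintype.card V + 1) * D) :=
    Derivable.biUnion_twist hGP hNP hDP tP hIP (Y ∪ Z) Z wP (Or.inl rfl)
  have hφQ : Derivable inp (∅ ∪ I) (⋃ N ∈ NQ, ⋃ x, coordFuns (φQ N x))
      (17 * (Fintype.card V + 1) * D) :=
    Derivable.biUnion_twist hGQ hNQ hDQ tQ hIQ Z (Y ∪ Z) 1 (Or.inr rfl)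
  let M : Multiset (Finset V × ((∀ v, X v) → Ω → BiDual)) :=
    NP.1.map (fun N => (N, φP N)) + NQ.1.map (fun N => (N, φQ N))
  have hφPd : ∀ N, DependsOn (φP N) (N : Set V) := fun N x y h => by
    funext ω
    simp only [φP, wP, gP, dependsOn_partMarginal tP Z N h, dependsOn_partLogRatio tP _ _ N h]
  have hφQd : ∀ N, DependsOn (φQ N) (N : Set V) := fun N x y h => by
    funext ω
    simp only [φQ, gQ, dependsOn_partLogRatio tQ _ _ N h]
  set B : Set (Ω → ℝ) :=
    (⋃ N ∈ NP, ⋃ x, coordFuns (φP N x)) ∪ ⋃ N ∈ NQ, ⋃ x, coordFuns (φQ N x) with hB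
  have hM : ∀ φ ∈ M, φ.1 ⊆ Finset.univ ∧ H.IsClique (φ.1 : Set V) ∧ DependsOn φ.2 φ.1 := by
    intro φ hφ
    simp only [M, Multiset.mem_add, Multiset.mem_map] at hφ
    rcases hφ with ⟨N, hN, rfl⟩ | ⟨N, hN, rfl⟩
    · exact ⟨Finset.subset_univ _, isClique_of_setsToCliques_le hHP hN, hφPd N⟩
    · exact ⟨Finset.subset_univ _, isClique_of_setsToCliques_le hHQ hN, hφQd N⟩
  have hMB : ∀ φ ∈ M, ∀ x, coordFuns (φ.2 x) ⊆ ∅ ∪ B := by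
    intro φ hφ x f hf
    simp only [M, Multiset.mem_add, Multiset.mem_map] at hφ
    rcases hφ with ⟨N, hN, rfl⟩ | ⟨N, hN, rfl⟩
    · exact Or.inr (Or.inl (Set.mem_biUnion (Finset.mem_coe.2 hN) (Set.mem_iUnion.2 ⟨x, hf⟩)))
    · exact Or.inr (Or.inr (Set.mem_biUnion (Finset.mem_coe.2 hN) (Set.mem_iUnion.2 ⟨x, hf⟩)))
  let S : Ω → BiDual := ∑ x, (M.map fun φ => φ.2 x).prod
  have hS : Derivable inp (∅ ∪ B) (coordFuns S)
      (36 * (M.card + 2 * (Finset.univ : Finset V).card + 1) * D) :=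
    Derivable.sum_prod hHc hD Finset.univ M hM hMB
  let q : ℚ := ((2 * ∏ v ∈ (Y ∪ Z)ᶜ, Fintype.card (X v) : ℕ) : ℚ)⁻¹
  have hcoord : Derivable inp (∅ ∪ coordFuns S) {fun ω => (q : ℝ) * (S ω).e} (1 + 0 + 1) :=
    (Derivable.const q).mul (.of_mem (Or.inr (Or.inr (Or.inr rfl))))
  have hall := ((hI.trans (hφP.union hφQ)).trans hS).trans hcoord
  obtain ⟨prog, hlen, hout⟩ := hall.exists_output
  refine ⟨prog, hlen.trans ?_, fun P Q => (hout (P, Q)).trans ?_⟩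
  · have hMc : M.card = NP.card + NQ.card := by
      simp only [M, Multiset.card_add, Multiset.card_map]
      rfl
    have h1 := hNP.card_le
    have h2 := hNQ.card_le
    have hn : 1 ≤ Fintype.card V := Fintype.card_pos
    have hn2 : Fintype.card V ≤ Fintype.card V ^ 2 := Nat.le_self_pow two_ne_zero _
    rw [Finset.card_univ]
    set n := Fintype.card V
    calc _ ≤ 2 * (n + 1) * D + (17 * (n + 1) * D + 17 * (n + 1) * D) +
          36 * (2 * (n + 1) + 2 * n + 1) * D + 3 * D := by
            have : 36 * (M.card + 2 * n + 1) * D ≤ 36 * (2 * (n + 1) + 2 * n + 1) * D :=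
              Nat.mul_le_mul_right _ (by omega)
            omega
      _ = (180 * n + 147) * D := by ring
      _ ≤ 327 * n ^ 2 * D := Nat.mul_le_mul_right _ (by omega)
      _ = _ := by ring
  · -- The coefficient of `ε δ` is the sum over all assignments of weight times squared exponent.
    have hfP := fun (ω : Ω) x => ω.1.factorizes x
    have hfQ := fun (ω : Ω) x => ω.2.factorizes x
    rw [condABDiv_zero_eq hd]
    congr 1
    · simp only [q]
      push_cast
      rfl
    · rw [show S (P, Q) = ∑ x, (M.map fun φ => φ.2 x).prod (P, Q) from Finset.sum_apply _ _ _,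
        BiDual.e_sum]
      refine Finset.sum_congr rfl fun x _ => ?_
      have hx : (M.map fun φ => φ.2 x).prod (P, Q) =
          BiDual.twist (∏ N ∈ NP, wP N x (P, Q))
            (∑ N ∈ NP, gP N x (P, Q) + ∑ N ∈ NQ, gQ N x (P, Q)) := by
        have : (M.map fun φ => φ.2 x).prod = (∏ N ∈ NP, φP N x) * ∏ N ∈ NQ, φQ N x := by
          simp only [M, Multiset.map_add, Multiset.prod_add, Multiset.map_map]
          rfl
        rw [this, Pi.mul_apply, Finset.prod_apply, Finset.prod_apply]
        simp only [φP, φQ]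
        rw [BiDual.prod_twist, BiDual.prod_twist, BiDual.twist_mul_twist, Finset.prod_const_one,
          mul_one]
      have hw := sumOut_compl_eq_prod_partMarginal (t := tP) hNP subset_rfl
        (p := fun ω => ω.1.prob) hfP (P, Q) x
      have hP := log_div_eq_sum_partLogRatio (t := tP) hNP
        (Finset.subset_union_right : Z ⊆ Y ∪ Z) subset_rfl
        (p := fun ω => ω.1.prob) hfP (fun ω => ω.1.prob_pos) (P, Q) x
      have hQ := log_div_eq_sum_partLogRatio (t := tQ) hNQ subset_rfl
        (Finset.subset_union_right : Z ⊆ Y ∪ Z)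
        (p := fun ω => ω.2.prob) hfQ (fun ω => ω.2.prob_pos) (P, Q) x
      simp only at hw hP hQ
      rw [hx, hP, hw, ← inv_div, Real.log_inv, hQ, sub_neg_eq_add, sq]
      rfl

end Bound

theorem mainTheorem4 :
    ∃ K : ℕ, ∀ (V : Type*) [Fintype V] [DecidableEq V] [Nonempty V]
      (X : V → Type*) [∀ v, Fintype (X v)] [∀ v, DecidableEq (X v)]
      (d : ℕ) (_ : ∀ v, Fintype.card (X v) ≤ d)
      (GP GQ : SimpleGraph V) (Y Z : Finset V) (_ : Disjoint Z Y)
      (NP NQ : Finset (Finset V)) (_ : IsNPartition GP Z NP) (_ : IsNPartition GQ Z NQ)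
      (H : SimpleGraph V)
      (_ : IsComputationGraph (setsToCliques NP) (setsToCliques NQ) H),
      ∃ prog : SLP (TableEntry GP X ⊕ TableEntry GQ X),
        prog.steps ≤ K * (Fintype.card V ^ 2 * d ^ (treewidth H + 1)) ∧
        ∀ (P : DecomposableModel GP X) (Q : DecomposableModel GQ X),
          prog.output (Sum.elim P.table Q.table) = condABDiv 0 0 P.prob Q.prob Y Z := by
  refine ⟨327, ?_⟩
  intro V _ _ _ X _ _ d hd GP GQ Y Z hYZ NP NQ hNP hNQ H hH
  by_cases hP : Nonempty (DecomposableModel GP X)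
  swap
  · exact ⟨[], Nat.zero_le _, fun P => (hP ⟨P⟩).elim⟩
  by_cases hQ : Nonempty (DecomposableModel GQ X)
  swap
  · exact ⟨[], Nat.zero_le _, fun _ Q => (hQ ⟨Q⟩).elim⟩
  obtain ⟨P⟩ := hP
  obtain ⟨Q⟩ := hQ
  -- A probability distribution exists only if every variable has a value.
  have hX : ∀ v, Nonempty (X v) := by
    by_contra hno
    push Not at hno
    obtain ⟨v, hv⟩ := hno
    have : IsEmpty (∀ v, X v) := ⟨fun x => hv.elim (x v)⟩
    exact zero_ne_one ((Finset.sum_of_isEmpty (f := P.prob) Finset.univ).symm.trans P.prob_sum)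
  refine exists_program_condABDiv P.chordal Q.chordal hYZ hNP hNQ hH fun S hS => ?_
  obtain ⟨v⟩ := ‹Nonempty V›
  have hd1 : 1 ≤ d := Fintype.card_pos.trans_le (hd v)
  calc ∏ v ∈ S, Fintype.card (X v) ≤ d ^ S.card := Finset.prod_le_pow_card _ _ _ fun v _ => hd v
    _ ≤ d ^ (treewidth H + 1) := Nat.pow_le_pow_right hd1 (by
      have := hS.card_le_cliqueNum
      rw [treewidth]
      omega)
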